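/- Let $A$ be a unital $C^*$-algebra and let $M$ be a correspondence over $A$, i.e. a right Hilbert $A$-module with a left action of $A$ given by a $*$-homomorphism of $A$ into the adjointable operators on $M$; assume that $M$ is essential: $1\cdot n=n$ for all $n\in M$. For a Hilbert $A$-module $X$, $X\otimes_A M$ denotes the internal tensor product, the completion of the algebraic tensor product for $\langle x\otimes n,y\otimes p\rangle=\langle n,\langle x,y\rangle\cdot p\rangle$. If $T:X\to Y$ preserves inner products, $T\otimes\mathrm{id}:X\otimes_AM\to Y\otimes_AM$ is the inner-product preserving map with $(T\otimes\mathrm{id})(x\otimes n)=Tx\otimes n$. Put $M^{\otimes 0}=A$ and $M^{\otimes(k+1)}=M^{\otimes k}\otimes_A M$ (so $M^{\otimes 1}=A\otimes_AM\cong M$ through $a\otimes n\mapsto a\cdot n$). Let $m\in M$ be a filter, i.e. $\langle m,m\rangle=1$. Let $T_k:M^{\otimes k}\to M^{\otimes (k+1)}$ be the inner-product preserving maps $T_k(n)=m\otimes n$ (that is, $T_0(a)=m\cdot a$ and $T_{k+1}=T_k\otimes\mathrm{id}$), and let $(M_\infty,\iota^k)=\varinjlim(M^{\otimes k},T_k)$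 be the direct limit of Hilbert $A$-modules, with its canonical inner-product preserving maps $\iota^k:M^{\otimes k}\to M_\infty$, which satisfy $\iota^{k+1}\circ T_k=\iota^k$. Let $(X,D,\phi)$ be a scaling function for $m$: $X$ is a Hilbert $A$-module, $D:X\to X\otimes_AM$ is an isomorphism of Hilbert $A$-modules, and $\phi\in X$ satisfies $\langle\phi,\phi\rangle=1$ and $D\phi=\phi\otimes m$. Let $D^k:X\to X\otimes_AM^{\otimes k}$ be the isomorphisms given by $D^0=\mathrm{id}$ and $D^{k+1}=(D^k\otimes\mathrm{id})\circ D$. Then there is an isomorphism of Hilbert $A$-modules $R:M_\infty\to M_\infty\otimes_AM$ such that $R\circ\iota^{k+1}=\iota^k\otimes\mathrm{id}$ for all $k\ge 0$, and there is an inner-product preserving map $Q:M_\infty\to X$ such that $Q(\iota^0(1))=\phi$ and $D\circ Q=(Q\otimes\mathrm{id})\circ R$. The submodules $V_k:=Q(\iota^k(M^{\otimes k}))$, $k\ge0$, form a projective multi-resolution analysis for the submodule $W:=Q(M_\infty)$ of $X$. This means the following: $W$ is closed and $D$ restricts to an isomorphism of $W$ onto $W\otimes_AM\subseteq X\otimes_AM$;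 every $V_k$ is contained in $W$; and (i) $V_0$ is a complemented submodule of $W$ (it is closed, and every $x\in W$ is a sum $v+w$ with $v\in V_0$ and $w\in W$ orthogonal to $V_0$); (ii) $V_k=(D^k)^{-1}(V_0\otimes_AM^{\otimes k})$ for all $k\ge0$, where $V_0\otimes_AM^{\otimes k}$ is regarded as a closed submodule of $X\otimes_AM^{\otimes k}$; (iii) $V_k$ is a complemented submodule of $V_{k+1}$ for all $k\ge0$; (iv) $\bigcup_{k}V_k$ is dense in $W$. Moreover, $V_0$ is the free rank-one $A$-module generated by $\phi$: $V_0=\{\phi\cdot a: a\in A\}$, and $a\mapsto\phi\cdot a$ is injective. -/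

import Mathlib

open scoped TensorProduct
open MulOpposite

universe u

/-- An `A`-valued pre-inner product on a complex vector space `E` carrying a compatible right action
of the `C⋆`-algebra `A` (written, as usual in Mathlib, as an action of `Aᵐᵒᵖ`, so `x · a` is
`op a • x`). It is `A`-linear in the second variable, and vectors of length zero are allowed. -/
structure PreInner (A : Type u) [CStarAlgebra A] [PartialOrder A] [StarOrderedRing A]
    (E : Type u) [AddCommGroup E] [Module ℂ E] [Module Aᵐᵒᵖ E] [IsScalarTower ℂ Aᵐᵒᵖ E] where
  inner : E → E → A
  inner_add_right : ∀ x y z, inner x (y + z) = inner x y + inner x z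
  inner_op_smul_right : ∀ (x y) (a : A), inner x (op a • y) = inner x y * a
  star_inner : ∀ x y, star (inner x y) = inner y x
  inner_self_nonneg : ∀ x, 0 ≤ inner x x

namespace PreInner

variable {A : Type u} [CStarAlgebra A] [PartialOrder A] [StarOrderedRing A]
  {E : Type u} [AddCommGroup E] [Module ℂ E] [Module Aᵐᵒᵖ E] [IsScalarTower ℂ Aᵐᵒᵖ E]
  {F : Type u} [AddCommGroup F] [Module ℂ F] [Module Aᵐᵒᵖ F] [IsScalarTower ℂ Aᵐᵒᵖ F]

theorem complex_smul (z : ℂ) (x : E) : z • x = op (algebraMap ℂ A z) • x := by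
  have h : (op (algebraMap ℂ A z) : Aᵐᵒᵖ) = z • (1 : Aᵐᵒᵖ) := by
    rw [Algebra.algebraMap_eq_smul_one]; rfl
  rw [h, smul_assoc, one_smul]

variable (S : PreInner A E)

theorem inner_add_left (x y z : E) : S.inner (x + y) z = S.inner x z + S.inner y z := by
  rw [← S.star_inner, S.inner_add_right, star_add, S.star_inner, S.star_inner]

theorem inner_op_smul_left (x y : E) (a : A) :
    S.inner (op a • x) y = star a * S.inner x y := by
  rw [← S.star_inner, S.inner_op_smul_right, star_mul, S.star_inner]

theorem inner_smul_right (x y : E) (z : ℂ) : S.inner x (z • y) = z • S.inner x y := by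
  rw [complex_smul (A := A), S.inner_op_smul_right, Algebra.algebraMap_eq_smul_one, mul_smul_comm,
    mul_one]

theorem inner_smul_left (x y : E) (z : ℂ) : S.inner (z • x) y = star z • S.inner x y := by
  rw [← S.star_inner, S.inner_smul_right, star_smul, S.star_inner]

/-- The pre-inner product as a sesquilinear map. -/
noncomputable def innerₛₗ : E →ₗ⋆[ℂ] E →ₗ[ℂ] A :=
  LinearMap.mk₂'ₛₗ _ _ S.inner S.inner_add_left (fun c x y => S.inner_smul_left x y c)
    S.inner_add_right (fun c x y => S.inner_smul_right x y c)

theorem innerₛₗ_apply (x y : E) : S.innerₛₗ x y = S.inner x y := rfl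

theorem inner_zero_right (x : E) : S.inner x 0 = 0 := (S.innerₛₗ x).map_zero

theorem inner_zero_left (x : E) : S.inner 0 x = 0 := by
  rw [← innerₛₗ_apply, map_zero, LinearMap.zero_apply]

theorem inner_sub_right (x y z : E) : S.inner x (y - z) = S.inner x y - S.inner x z :=
  (S.innerₛₗ x).map_sub y z

theorem inner_sub_left (x y z : E) : S.inner (x - y) z = S.inner x z - S.inner y z := by
  rw [← S.star_inner, S.inner_sub_right, star_sub, S.star_inner, S.star_inner]

theorem norm_inner_sq_le (x y : E) :
    ‖S.inner x y‖ ^ 2 ≤ ‖S.inner x x‖ * ‖S.inner y y‖ := by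
  have key : ∀ c : ℝ, ‖S.inner x x‖ < c → ‖S.inner x y‖ ^ 2 ≤ c * ‖S.inner y y‖ := by
    intro c hc
    have hc0 : 0 < c := (norm_nonneg _).trans_lt hc
    set a := S.inner x y with ha
    have h1 : 0 ≤ S.inner (op a • x - (c : ℂ) • y) (op a • x - (c : ℂ) • y) :=
      S.inner_self_nonneg _
    have h2 : S.inner (op a • x - (c : ℂ) • y) (op a • x - (c : ℂ) • y)
        = star a * S.inner x x * a - c • (star a * a) - c • (star a * a)
          + c • c • S.inner y y := by
      have hyx : S.inner y x = star a := by rw [ha, S.star_inner]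
      rw [S.inner_sub_right, S.inner_sub_left, S.inner_sub_left, S.inner_op_smul_right,
        S.inner_op_smul_right, S.inner_op_smul_left, S.inner_op_smul_left, S.inner_smul_left,
        S.inner_smul_left, S.inner_smul_right, S.inner_smul_right, hyx, ← ha, Complex.star_def,
        Complex.conj_ofReal, Complex.coe_smul, Complex.coe_smul, Complex.coe_smul,
        smul_mul_assoc, mul_smul_comm]
      simp only [Complex.coe_smul]
      abel
    have h3 : star a * S.inner x x * a ≤ c • (star a * a) :=
      (CStarAlgebra.star_left_conjugate_le_norm_smul (a := a) (b := S.inner x x)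
        (hb := IsSelfAdjoint.of_nonneg (S.inner_self_nonneg x))).trans
        (smul_le_smul_of_nonneg_right hc.le (star_mul_self_nonneg a))
    have h4 : c • (star a * a) ≤ c • c • S.inner y y := by
      have := h1.trans_eq h2
      have h5 : 0 ≤ c • (star a * a) - c • (star a * a) - c • (star a * a)
          + c • c • S.inner y y := by
        refine this.trans ?_
        gcongr
      simpa [add_comm, ← sub_eq_add_neg, sub_nonneg] using h5
    have h5 : star a * a ≤ c • S.inner y y := (smul_le_smul_iff_of_pos_left hc0).1 h4
    have h6 := CStarAlgebra.norm_le_norm_of_nonneg_of_le (star_mul_self_nonneg a) h5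
    rw [CStarRing.norm_star_mul_self, norm_smul, Real.norm_of_nonneg hc0.le] at h6
    rwa [sq]
  have hT : Filter.Tendsto (fun c : ℝ => c * ‖S.inner y y‖) (nhdsWithin ‖S.inner x x‖
      (Set.Ioi ‖S.inner x x‖)) (nhds (‖S.inner x x‖ * ‖S.inner y y‖)) :=
    ((continuous_id.mul continuous_const).tendsto _).mono_left nhdsWithin_le_nhds
  exact ge_of_tendsto hT (Filter.eventually_of_mem self_mem_nhdsWithin fun c hc => key c hc)

/-- The vector space `E` regarded as a seminormed space, with `‖x‖ = ‖⟨x, x⟩‖ ^ (1/2)`. -/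
@[nolint unusedArguments]
def Space (_ : PreInner A E) : Type u := E

namespace Space

instance : AddCommGroup S.Space := inferInstanceAs (AddCommGroup E)
instance : Module ℂ S.Space := inferInstanceAs (Module ℂ E)
instance : Module Aᵐᵒᵖ S.Space := inferInstanceAs (Module Aᵐᵒᵖ E)
instance : IsScalarTower ℂ Aᵐᵒᵖ S.Space := inferInstanceAs (IsScalarTower ℂ Aᵐᵒᵖ E)

/-- The pre-inner product, on `S.Space`. -/
def form : PreInner A S.Space := S

noncomputable instance : Norm S.Space := ⟨fun x => √‖(form S).inner x x‖⟩

theorem norm_def (x : S.Space) : ‖x‖ = √‖(form S).inner x x‖ := rfl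

theorem norm_sq (x : S.Space) : ‖x‖ ^ 2 = ‖(form S).inner x x‖ := Real.sq_sqrt (norm_nonneg _)

theorem norm_inner_le (x y : S.Space) : ‖(form S).inner x y‖ ≤ ‖x‖ * ‖y‖ := by
  refine le_of_sq_le_sq ?_ (mul_nonneg (Real.sqrt_nonneg _) (Real.sqrt_nonneg _))
  rw [mul_pow, norm_sq, norm_sq]
  exact (form S).norm_inner_sq_le x y

theorem core : SeminormedSpace.Core ℂ S.Space where
  norm_nonneg x := Real.sqrt_nonneg _
  norm_smul c x := by
    change √‖(form S).inner (c • x) (c • x)‖ = ‖c‖ * √‖(form S).inner x x‖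
    rw [(form S).inner_smul_left, (form S).inner_smul_right, norm_smul, norm_smul, ← mul_assoc, norm_star,
      ← sq, Real.sqrt_mul (sq_nonneg _), Real.sqrt_sq (norm_nonneg _)]
  norm_triangle x y := by
    have hn : ∀ z : S.Space, 0 ≤ ‖z‖ := fun z => Real.sqrt_nonneg _
    refine le_of_sq_le_sq ?_ (add_nonneg (hn x) (hn y))
    rw [norm_sq]
    change ‖(form S).inner (x + y) (x + y)‖ ≤ _
    rw [(form S).inner_add_left, (form S).inner_add_right, (form S).inner_add_right]
    calc _ ≤ ‖(form S).inner x x‖ + ‖(form S).inner x y‖ + (‖(form S).inner y x‖ + ‖(form S).inner y y‖) :=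
          (norm_add_le _ _).trans (add_le_add (norm_add_le _ _) (norm_add_le _ _))
      _ ≤ ‖x‖ ^ 2 + ‖x‖ * ‖y‖ + (‖y‖ * ‖x‖ + ‖y‖ ^ 2) := by
          rw [norm_sq, norm_sq]
          gcongr
          · exact norm_inner_le S x y
          · exact norm_inner_le S y x
      _ = _ := by ring

noncomputable instance : SeminormedAddCommGroup S.Space := .ofCore (core S)

noncomputable instance : NormedSpace ℂ S.Space where
  norm_smul_le c x := ((core S).norm_smul c x).le

theorem norm_op_smul_le (a : Aᵐᵒᵖ) (x : S.Space) : ‖a • x‖ ≤ ‖a‖ * ‖x‖ := by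
  refine le_of_sq_le_sq ?_ (by positivity)
  rw [mul_pow, norm_sq, norm_sq]
  change ‖(form S).inner (op a.unop • x) (op a.unop • x)‖ ≤ _
  rw [(form S).inner_op_smul_left, (form S).inner_op_smul_right]
  calc _ ≤ ‖star a.unop‖ * (‖(form S).inner x x‖ * ‖a.unop‖) :=
        (norm_mul_le _ _).trans (by gcongr; exact norm_mul_le _ _)
    _ = _ := by rw [norm_star, MulOpposite.norm_unop]; ring

instance : UniformContinuousConstSMul Aᵐᵒᵖ S.Space where
  uniformContinuous_const_smul a :=
    (AddMonoidHomClass.lipschitz_of_bound (DistribSMul.toAddMonoidHom S.Space a) ‖a‖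
      (norm_op_smul_le S a)).uniformContinuous

theorem continuous_inner : Continuous fun p : S.Space × S.Space => (form S).inner p.1 p.2 := by
  let B : S.Space →L⋆[ℂ] S.Space →L[ℂ] A :=
    LinearMap.mkContinuous₂ ((form S).innerₛₗ : S.Space →ₗ⋆[ℂ] S.Space →ₗ[ℂ] A) 1
      (fun x y => by rw [one_mul]; exact norm_inner_le S x y)
  exact (B.continuous.comp continuous_fst).clm_apply continuous_snd

end Space

end PreInner

/-- A right Hilbert module over the `C⋆`-algebra `A`: a complex Banach space with a right
`A`-action (as an action of `Aᵐᵒᵖ`) and an `A`-valued inner product, linear in the second variable,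
such that `‖x‖² = ‖⟨x, x⟩‖`; definiteness is part of the norm axioms. (Mathlib's `CStarModule A E`
is the mirror image of this notion: its inner product is linear for a left action of `A`.) -/
structure HilbertModule (A : Type u) [CStarAlgebra A] [PartialOrder A] [StarOrderedRing A] where
  carrier : Type u
  [normedAddCommGroup : NormedAddCommGroup carrier]
  [normedSpace : NormedSpace ℂ carrier]
  [module : Module Aᵐᵒᵖ carrier]
  [isScalarTower : IsScalarTower ℂ Aᵐᵒᵖ carrier]
  [completeSpace : CompleteSpace carrier]
  form : PreInner A carrier
  norm_sq : ∀ x, ‖x‖ ^ 2 = ‖form.inner x x‖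

attribute [instance] HilbertModule.normedAddCommGroup HilbertModule.normedSpace
  HilbertModule.module HilbertModule.isScalarTower HilbertModule.completeSpace

instance {A : Type u} [CStarAlgebra A] [PartialOrder A] [StarOrderedRing A] :
    CoeSort (HilbertModule A) (Type u) := ⟨HilbertModule.carrier⟩

/-- `⟪x, y⟫` is the `A`-valued inner product of a Hilbert `A`-module. -/
def HilbertModule.inner {A : Type u} [CStarAlgebra A] [PartialOrder A] [StarOrderedRing A]
    {X : HilbertModule A} (x y : X) : A := X.form.inner x y

local notation "⟪" x ", " y "⟫" => HilbertModule.inner x y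

/-- An inner-product preserving map between Hilbert `A`-modules (not necessarily adjointable). -/
structure InnerMap {A : Type u} [CStarAlgebra A] [PartialOrder A] [StarOrderedRing A]
    (X Y : HilbertModule A) extends X →ₗ[Aᵐᵒᵖ] Y where
  inner_map : ∀ x y, ⟪toFun x, toFun y⟫ = ⟪x, y⟫

/-- An isomorphism of Hilbert `A`-modules. -/
structure HilbertModuleIso {A : Type u} [CStarAlgebra A] [PartialOrder A] [StarOrderedRing A]
    (X Y : HilbertModule A) extends X ≃ₗ[Aᵐᵒᵖ] Y where
  inner_map : ∀ x y, ⟪toFun x, toFun y⟫ = ⟪x, y⟫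

section

variable {A : Type u} [CStarAlgebra A] [PartialOrder A] [StarOrderedRing A]

namespace InnerMap

variable {X Y Z : HilbertModule A}

instance : FunLike (InnerMap X Y) X Y where
  coe T := T.toFun
  coe_injective S T h := by
    cases S; cases T; congr; exact DFunLike.coe_injective h

instance : AddMonoidHomClass (InnerMap X Y) X Y where
  map_add T := T.map_add'
  map_zero T := T.toLinearMap.map_zero

theorem map_op_smul (T : InnerMap X Y) (a : Aᵐᵒᵖ) (x : X) : T (a • x) = a • T x :=
  T.toLinearMap.map_smul a x

theorem inner_apply (T : InnerMap X Y) (x y : X) : ⟪T x, T y⟫ = ⟪x, y⟫ := T.inner_map x y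

theorem map_smul (T : InnerMap X Y) (c : ℂ) (x : X) : T (c • x) = c • T x := by
  rw [PreInner.complex_smul (A := A), PreInner.complex_smul (A := A), T.map_op_smul]

/-- The identity map. -/
def id (X : HilbertModule A) : InnerMap X X := ⟨LinearMap.id, fun _ _ => rfl⟩

/-- Composition. -/
def comp (S : InnerMap Y Z) (T : InnerMap X Y) : InnerMap X Z :=
  ⟨S.toLinearMap ∘ₗ T.toLinearMap, fun x y => (S.inner_map _ _).trans (T.inner_map x y)⟩

end InnerMap

namespace HilbertModuleIso

variable {X Y : HilbertModule A}

/-- A Hilbert module isomorphism as an inner-product preserving map. -/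
def toInnerMap (U : HilbertModuleIso X Y) : InnerMap X Y :=
  ⟨U.toLinearEquiv.toLinearMap, U.inner_map⟩

instance : FunLike (HilbertModuleIso X Y) X Y where
  coe T := T.toFun
  coe_injective S T h := by
    cases S; cases T; congr; exact DFunLike.coe_injective h

end HilbertModuleIso

theorem HilbertModule.continuous_inner (X : HilbertModule A) :
    Continuous fun p : X × X => ⟪p.1, p.2⟫ := by
  let B : X →L⋆[ℂ] X →L[ℂ] A :=
    LinearMap.mkContinuous₂ X.form.innerₛₗ 1 (fun x y => by
      rw [one_mul]
      refine le_of_sq_le_sq ?_ (by positivity)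
      rw [mul_pow, X.norm_sq, X.norm_sq]
      exact X.form.norm_inner_sq_le x y)
  exact (B.continuous.comp continuous_fst).clm_apply continuous_snd

theorem HilbertModule.norm_op_smul_le {X : HilbertModule A} (a : Aᵐᵒᵖ) (x : X) :
    ‖a • x‖ ≤ ‖a‖ * ‖x‖ := by
  refine le_of_sq_le_sq ?_ (by positivity)
  rw [mul_pow, X.norm_sq, X.norm_sq]
  change ‖X.form.inner (op a.unop • x) (op a.unop • x)‖ ≤ _
  rw [X.form.inner_op_smul_left, X.form.inner_op_smul_right]
  calc _ ≤ ‖star a.unop‖ * (‖X.form.inner x x‖ * ‖a.unop‖) :=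
        (norm_mul_le _ _).trans (by gcongr; exact norm_mul_le _ _)
    _ = _ := by rw [norm_star, MulOpposite.norm_unop]; ring

instance (X : HilbertModule A) : ContinuousConstSMul Aᵐᵒᵖ X where
  continuous_const_smul a :=
    (AddMonoidHomClass.lipschitz_of_bound (DistribSMul.toAddMonoidHom X a) ‖a‖
      (HilbertModule.norm_op_smul_le a)).continuous

/-! ### Completion -/

namespace PreInner

open UniformSpace

variable {E : Type u} [AddCommGroup E] [Module ℂ E] [Module Aᵐᵒᵖ E] [IsScalarTower ℂ Aᵐᵒᵖ E]
  (S : PreInner A E)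

/-- The continuous extension of the pre-inner product to the completion. -/
noncomputable def innerC (x y : Completion S.Space) : A :=
  (Completion.isDenseInducing_coe.prodMap Completion.isDenseInducing_coe).extend
    (fun p : S.Space × S.Space => (Space.form S).inner p.1 p.2) (x, y)

theorem innerC_coe (x y : S.Space) :
    S.innerC (x : Completion S.Space) (y : Completion S.Space) = (Space.form S).inner x y :=
  (Completion.isDenseInducing_coe.prodMap Completion.isDenseInducing_coe).extend_eq
    (Space.continuous_inner S) (x, y)

theorem continuous_innerC :
    Continuous fun p : Completion S.Space × Completion S.Space => S.innerC p.1 p.2 := by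
  let φ : S.Space →+ S.Space →+ A :=
    { toFun := fun x => ((Space.form S).innerₛₗ x).toAddMonoidHom
      map_zero' := by ext x; exact (Space.form S).inner_zero_left _
      map_add' := fun x y => by ext z; exact (Space.form S).inner_add_left _ _ _ }
  have h : Continuous fun p : S.Space × S.Space => φ p.1 p.2 := Space.continuous_inner S
  exact (Completion.isDenseInducing_toCompl S.Space).extend_Z_bilin
    (Completion.isDenseInducing_toCompl S.Space) h

theorem continuous_innerC' {α : Type*} [TopologicalSpace α] {f g : α → Completion S.Space}
    (hf : Continuous f) (hg : Continuous g) : Continuous fun t => S.innerC (f t) (g t) :=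
  S.continuous_innerC.comp (hf.prodMk hg)

/-- The Hilbert `A`-module obtained from a pre-inner product by dividing out the vectors of length
zero and completing (`Completion` is the Hausdorff completion). -/
noncomputable def completion : HilbertModule A where
  carrier := Completion S.Space
  form :=
    { inner := S.innerC
      inner_add_right := fun x y z => by
        induction x, y, z using Completion.induction_on₃ with
        | hp =>
          exact isClosed_eq
            (S.continuous_innerC' (by fun_prop) (by fun_prop))
            ((S.continuous_innerC' (by fun_prop) (by fun_prop)).add
              (S.continuous_innerC' (by fun_prop) (by fun_prop)))
        | ih x y z =>
          rw [← Completion.coe_add, innerC_coe, innerC_coe, innerC_coe,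
            (Space.form S).inner_add_right]
      inner_op_smul_right := fun x y a => by
        induction x, y using Completion.induction_on₂ with
        | hp =>
          exact isClosed_eq
            (S.continuous_innerC' continuous_fst
              ((continuous_const_smul (op a)).comp continuous_snd))
            ((S.continuous_innerC' continuous_fst continuous_snd).mul continuous_const)
        | ih x y =>
          rw [← Completion.coe_smul, innerC_coe, innerC_coe, (Space.form S).inner_op_smul_right]
      star_inner := fun x y => by
        induction x, y using Completion.induction_on₂ with
        | hp =>
          exact isClosed_eq
            (S.continuous_innerC' continuous_fst continuous_snd).star
            (S.continuous_innerC' continuous_snd continuous_fst)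
        | ih x y => rw [innerC_coe, innerC_coe, (Space.form S).star_inner]
      inner_self_nonneg := fun x => by
        induction x using Completion.induction_on with
        | hp =>
          exact CStarAlgebra.isClosed_nonneg.preimage
            (S.continuous_innerC' continuous_id continuous_id)
        | ih x => rw [innerC_coe]; exact (Space.form S).inner_self_nonneg x }
  norm_sq := fun x => by
    induction x using Completion.induction_on with
    | hp =>
      exact isClosed_eq (by fun_prop) (S.continuous_innerC' continuous_id continuous_id).norm
    | ih x =>
      change _ = ‖S.innerC (x : Completion S.Space) (x : Completion S.Space)‖
      rw [innerC_coe, Completion.norm_coe, Space.norm_sq]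

/-- The class in the completion of a vector. -/
noncomputable def toCompletion : E →ₗ[Aᵐᵒᵖ] S.completion where
  toFun x := ((show S.Space from x : S.Space) : Completion S.Space)
  map_add' x y := Completion.coe_add (α := S.Space) x y
  map_smul' a x := Completion.coe_smul (X := S.Space) a x

theorem inner_toCompletion (x y : E) :
    ⟪S.toCompletion x, S.toCompletion y⟫ = S.inner x y := S.innerC_coe x y

theorem denseRange_toCompletion : DenseRange S.toCompletion :=
  Completion.denseRange_coe (α := S.Space)

theorem completion_induction {p : S.completion → Prop} (x : S.completion)
    (hp : IsClosed {x | p x}) (ih : ∀ e, p (S.toCompletion e)) : p x :=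
  S.denseRange_toCompletion.induction_on x hp ih

theorem completion_induction₂ {p : S.completion → S.completion → Prop} (x y : S.completion)
    (hp : IsClosed {x : S.completion × S.completion | p x.1 x.2})
    (ih : ∀ e f, p (S.toCompletion e) (S.toCompletion f)) : p x y :=
  S.denseRange_toCompletion.induction_on₂ hp ih x y

variable {S}

theorem norm_map_eq {Z : HilbertModule A} {f : E →ₗ[Aᵐᵒᵖ] Z}
    (hf : ∀ x y, ⟪f x, f y⟫ = S.inner x y) (x : E) : ‖f x‖ = ‖(show S.Space from x)‖ := by
  refine (sq_eq_sq₀ (norm_nonneg _) (norm_nonneg _)).1 ?_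
  rw [Z.norm_sq, Space.norm_sq]
  exact congrArg norm (hf x x)

/-- The continuous extension to the completion of a map that preserves the pre-inner product. -/
noncomputable def extendFun {Z : HilbertModule A} (f : E →ₗ[Aᵐᵒᵖ] Z) : S.completion → Z :=
  Completion.extension (fun x : S.Space => f x)

theorem continuous_extendFun {Z : HilbertModule A} (f : E →ₗ[Aᵐᵒᵖ] Z) :
    Continuous (extendFun (S := S) f) := Completion.continuous_extension

theorem extendFun_toCompletion {Z : HilbertModule A} (f : E →ₗ[Aᵐᵒᵖ] Z)
    (hf : ∀ x y, ⟪f x, f y⟫ = S.inner x y) (x : E) :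
    extendFun f (S.toCompletion x) = f x := by
  let f' : S.Space →+ Z := AddMonoidHom.mk' (fun x : S.Space => f x) (fun x y => f.map_add x y)
  have hu : UniformContinuous f' :=
    (AddMonoidHomClass.isometry_of_norm (E := S.Space) f'
      (fun x => norm_map_eq hf x)).uniformContinuous
  exact Completion.extension_coe hu x

/-- An `A`-linear map into a Hilbert module that preserves the pre-inner product extends to an
inner-product preserving map on the completion. -/
noncomputable def extend {Z : HilbertModule A} (f : E →ₗ[Aᵐᵒᵖ] Z)
    (hf : ∀ x y, ⟪f x, f y⟫ = S.inner x y) : InnerMap S.completion Z where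
  toFun := extendFun f
  map_add' x y := by
    have hc := continuous_extendFun (S := S) f
    refine S.completion_induction₂ (p := fun x y => extendFun f (x + y) =
      extendFun f x + extendFun f y) x y (isClosed_eq (hc.comp continuous_add)
      ((hc.comp continuous_fst).add (hc.comp continuous_snd))) fun e e' => ?_
    rw [← map_add, extendFun_toCompletion f hf, extendFun_toCompletion f hf,
      extendFun_toCompletion f hf, map_add]
  map_smul' a x := by
    have hc := continuous_extendFun (S := S) f
    refine S.completion_induction (p := fun x => extendFun f (a • x) = a • extendFun f x) x
      (isClosed_eq (hc.comp (continuous_const_smul a))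
      (hc.const_smul a)) fun e => ?_
    rw [← map_smul, extendFun_toCompletion f hf, extendFun_toCompletion f hf, map_smul]
  inner_map x y := by
    have hc := continuous_extendFun (S := S) f
    refine S.completion_induction₂
      (p := fun x y => ⟪extendFun f x, extendFun f y⟫ = ⟪x, y⟫) x y (isClosed_eq
      ((HilbertModule.continuous_inner Z).comp
        ((hc.comp continuous_fst).prodMk (hc.comp continuous_snd)))
      (HilbertModule.continuous_inner _)) fun e e' => ?_
    rw [extendFun_toCompletion f hf, extendFun_toCompletion f hf, hf, inner_toCompletion]

theorem extend_toCompletion {Z : HilbertModule A} (f : E →ₗ[Aᵐᵒᵖ] Z)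
    (hf : ∀ x y, ⟪f x, f y⟫ = S.inner x y) (x : E) :
    extend f hf (S.toCompletion x) = f x := extendFun_toCompletion f hf x

end PreInner

/-! ### Positivity of Gram matrices -/

/-- The algebraic part of the proof that a positive operator is of the form `b⋆ b`. -/
theorem exists_gram_aux {B : Type u} [CStarAlgebra B] (t : B) (ht : IsSelfAdjoint t) :
    ∃ c s : B, star s * t * s = -(star (c * s) * (c * s)) ∧
      (c * s = 0 → ∃ b : B, t = star b * b) := by
  let _ : PartialOrder B := CStarAlgebra.spectralOrder _
  have _ : StarOrderedRing B := CStarAlgebra.spectralOrderedRing _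
  obtain ⟨s, hs⟩ : ∃ s, s = t⁻ := ⟨_, rfl⟩
  have hs0 : 0 ≤ s := hs ▸ CFC.negPart_nonneg t
  have hsa : star s = s := (IsSelfAdjoint.of_nonneg hs0).star_eq
  have hts : t⁺ - s = t := hs ▸ CFC.posPart_sub_negPart t ht
  have hps : t⁺ * s = 0 := hs ▸ CFC.posPart_mul_negPart t
  obtain ⟨c, hc⟩ := CStarAlgebra.nonneg_iff_eq_star_mul_self.1 hs0
  refine ⟨c, s, ?_, fun h => ?_⟩
  · have h1 : t * s = -(s * s) := by
      conv_lhs => rw [← hts]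
      rw [sub_mul, hps, zero_sub]
    have h2 : star c * (c * s) = s * s := by rw [← mul_assoc, ← hc]
    rw [mul_assoc, h1, star_mul, hsa, mul_assoc, h2, mul_neg]
  · have h8 : s = 0 := by
      have h9 : star s * s = 0 := by
        rw [hsa]
        nth_rewrite 1 [hc]
        rw [mul_assoc, h, mul_zero]
      exact CStarRing.star_mul_self_eq_zero_iff _ |>.1 h9
    have h10 : 0 ≤ t := by
      rw [← hts, h8, sub_zero]
      exact CFC.posPart_nonneg t
    exact CStarAlgebra.nonneg_iff_eq_star_mul_self.1 h10

/-- A matrix over `A` with `∑ vᵢ⋆ gᵢⱼ vⱼ ≥ 0` for all `v` is of the form `b⋆ b`. -/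
theorem exists_gram {n : Type u} [Fintype n] (g : n → n → A)
    (hs : ∀ i j, star (g i j) = g j i)
    (hg : ∀ v : n → A, 0 ≤ ∑ i, ∑ j, star (v i) * g i j * v j) :
    ∃ b : n → n → A, ∀ i j, g i j = ∑ k, star (b k i) * b k j := by
  classical
  let t : CStarMatrix n n A := CStarMatrix.ofMatrix (Matrix.of g)
  have ht : IsSelfAdjoint t := by
    ext i j
    exact hs j i
  obtain ⟨c, s, h1, hb⟩ := exists_gram_aux t ht
  have h2 : ∀ k, (star (c * s) * (c * s)) k k ≤ 0 := by
    intro k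
    have h := hg (fun i => s i k)
    have h3 : (star s * t * s) k k = ∑ i, ∑ j, star (s i k) * g i j * s j k := by
      simp only [CStarMatrix.mul_apply, CStarMatrix.star_apply, Finset.sum_mul]
      rw [Finset.sum_comm]
      rfl
    rw [← h3, h1, CStarMatrix.neg_apply] at h
    exact neg_nonneg.1 h
  have h4 : c * s = 0 := by
    ext i k
    have h5 : ∑ l, star ((c * s) l k) * (c * s) l k ≤ 0 := by
      have := h2 k
      rwa [CStarMatrix.mul_apply] at this
    have h6 : star ((c * s) i k) * (c * s) i k ≤ 0 :=
      (Finset.single_le_sum (f := fun l => star ((c * s) l k) * (c * s) l k)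
        (fun l _ => star_mul_self_nonneg _) (Finset.mem_univ i)).trans h5
    have h7 := le_antisymm h6 (star_mul_self_nonneg _)
    exact CStarRing.star_mul_self_eq_zero_iff _ |>.1 h7
  obtain ⟨b, hb⟩ := hb h4
  refine ⟨fun i j => b i j, fun i j => ?_⟩
  have : t i j = (star b * b) i j := by rw [← hb]
  rw [CStarMatrix.mul_apply] at this
  exact this

/-! ### Correspondences and internal tensor products -/

variable (A) in
/-- The `C⋆`-algebra `A` as a Hilbert module `A_A` over itself, with `⟨a, b⟩ = a⋆ b`. -/
noncomputable def HilbertModule.self : HilbertModule A where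
  carrier := A
  form :=
    { inner := fun a b => star a * b
      inner_add_right := fun a b c => mul_add _ _ _
      inner_op_smul_right := fun a b c => (mul_assoc _ _ _).symm
      star_inner := fun a b => by rw [star_mul, star_star]
      inner_self_nonneg := fun a => star_mul_self_nonneg a }
  norm_sq := fun a => by rw [CStarRing.norm_star_mul_self, sq]

variable (A) in
/-- A correspondence over `A`: a right Hilbert `A`-module with a left action of `A` by adjointable
operators, `a ↦ left a` being a `⋆`-homomorphism, so that the adjoint of `left a` is
`left (star a)`. (Linearity over the right action and boundedness of each `left a` are automatic.)
It is not assumed that `left 1` is the identity. -/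
structure Correspondence extends HilbertModule A where
  left : A →ₙₐ[ℂ] Module.End ℂ carrier
  inner_left : ∀ a x y, form.inner (left a x) y = form.inner x (left (star a) y)

instance : CoeSort (Correspondence A) (Type u) := ⟨fun M => M.carrier⟩

theorem Correspondence.left_op_smul (M : Correspondence A) (a : A) (b : Aᵐᵒᵖ) (x : M) :
    M.left a (b • x) = b • M.left a x := by
  have h : ∀ y : M, M.form.inner y (M.left a (b • x) - b • M.left a x) = 0 := fun y => by
    rw [M.form.inner_sub_right, ← op_unop b, M.form.inner_op_smul_right, ← star_star a,
      ← M.inner_left, ← M.inner_left, M.form.inner_op_smul_right, sub_self]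
  have h2 := M.norm_sq (M.left a (b • x) - b • M.left a x)
  rw [h, norm_zero, sq_eq_zero_iff, norm_eq_zero, sub_eq_zero] at h2
  exact h2

/-- The correspondence is essential: `1 · x = x`. -/
def Correspondence.IsEssential (M : Correspondence A) : Prop := ∀ x : M, M.left 1 x = x

/-- The algebraic tensor product `X ⊙ M` over `ℂ`, with `A` acting on the right of `M`. -/
def AlgTensor (X : HilbertModule A) (M : Correspondence A) : Type u := X ⊗[ℂ] M

namespace AlgTensor

variable (X : HilbertModule A) (M : Correspondence A)

noncomputable instance : AddCommGroup (AlgTensor X M) := inferInstanceAs (AddCommGroup (X ⊗[ℂ] M))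
noncomputable instance : Module ℂ (AlgTensor X M) := inferInstanceAs (Module ℂ (X ⊗[ℂ] M))

/-- The right action of `A` on `X ⊙ M`, as a ring homomorphism into the endomorphisms. -/
noncomputable def rightAction : Aᵐᵒᵖ →+* Module.End ℂ (AlgTensor X M) where
  toFun a := LinearMap.lTensor X (Module.toModuleEnd ℂ M a)
  map_one' := by rw [map_one]; exact LinearMap.lTensor_id _ _
  map_mul' a b := by rw [map_mul]; exact LinearMap.lTensor_mul _ _ _
  map_zero' := by rw [map_zero]; exact LinearMap.lTensor_zero _
  map_add' a b := by rw [map_add]; exact LinearMap.lTensor_add _ _ _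

noncomputable instance : Module Aᵐᵒᵖ (AlgTensor X M) := Module.compHom _ (rightAction X M)

instance : IsScalarTower ℂ Aᵐᵒᵖ (AlgTensor X M) where
  smul_assoc c a z := by
    change LinearMap.lTensor X (Module.toModuleEnd ℂ M (c • a)) z
      = c • LinearMap.lTensor X (Module.toModuleEnd ℂ M a) z
    have h : Module.toModuleEnd ℂ (S := Aᵐᵒᵖ) M (c • a) = c • Module.toModuleEnd ℂ M a := by
      ext n
      exact smul_assoc c a n
    rw [h, LinearMap.lTensor_smul]
    rfl

variable {X M}

/-- The elementary tensor `x ⊗ n` in `X ⊙ M`. -/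
def tmul (x : X) (n : M) : AlgTensor X M := x ⊗ₜ[ℂ] n

theorem op_smul_tmul (a : Aᵐᵒᵖ) (x : X) (n : M) : a • tmul x n = tmul x (a • n) := rfl

@[elab_as_elim]
theorem induction_on {p : AlgTensor X M → Prop} (z : AlgTensor X M) (zero : p 0)
    (tmul : ∀ x n, p (tmul x n)) (add : ∀ z w, p z → p w → p (z + w)) : p z :=
  TensorProduct.induction_on (motive := p) z zero tmul add

/-- For fixed `x, n`, the map `y ⊗ p ↦ ⟨n, ⟨x, y⟩ · p⟩`. -/
noncomputable def innerAux (x : X) (n : M) : AlgTensor X M →ₗ[ℂ] A :=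
  TensorProduct.lift (LinearMap.mk₂ ℂ (fun y p => M.form.inner n (M.left (X.form.inner x y) p))
    (fun y y' p => by
      rw [X.form.inner_add_right, map_add, LinearMap.add_apply, M.form.inner_add_right])
    (fun c y p => by
      rw [X.form.inner_smul_right, map_smul, LinearMap.smul_apply, M.form.inner_smul_right])
    (fun y p p' => by rw [map_add, M.form.inner_add_right])
    (fun c y p => by rw [map_smul, M.form.inner_smul_right]))

theorem innerAux_tmul (x y : X) (n p : M) :
    innerAux x n (tmul y p) = M.form.inner n (M.left (X.form.inner x y) p) := rfl

theorem hom_ext {f g : AlgTensor X M →ₗ[ℂ] A} (h : ∀ x n, f (tmul x n) = g (tmul x n)) : f = g :=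
  TensorProduct.ext' h

variable (X M) in
/-- The pre-inner product as a sesquilinear map. -/
noncomputable def innerLin : AlgTensor X M →ₗ⋆[ℂ] AlgTensor X M →ₗ[ℂ] A :=
  TensorProduct.lift (LinearMap.mk₂'ₛₗ (starRingEnd ℂ) (starRingEnd ℂ) innerAux
    (fun x x' n => hom_ext fun y p => by
      rw [LinearMap.add_apply, innerAux_tmul, innerAux_tmul, innerAux_tmul,
        X.form.inner_add_left, map_add, LinearMap.add_apply, M.form.inner_add_right])
    (fun c x n => hom_ext fun y p => by
      rw [LinearMap.smul_apply, innerAux_tmul, innerAux_tmul, X.form.inner_smul_left, map_smul,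
        LinearMap.smul_apply, M.form.inner_smul_right]; rfl)
    (fun x n n' => hom_ext fun y p => by
      rw [LinearMap.add_apply, innerAux_tmul, innerAux_tmul, innerAux_tmul,
        M.form.inner_add_left])
    (fun c x n => hom_ext fun y p => by
      rw [LinearMap.smul_apply, innerAux_tmul, innerAux_tmul, M.form.inner_smul_left]; rfl))

theorem innerLin_tmul (x y : X) (n p : M) :
    innerLin X M (tmul x n) (tmul y p) = M.form.inner n (M.left (X.form.inner x y) p) := rfl

theorem innerLin_star (z w : AlgTensor X M) : star (innerLin X M z w) = innerLin X M w z := by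
  induction z using induction_on with
  | zero => rw [map_zero, map_zero, LinearMap.zero_apply, star_zero]
  | add z z' h h' => rw [map_add, map_add, LinearMap.add_apply, star_add, h, h']
  | tmul x n =>
    induction w using induction_on with
    | zero => rw [map_zero, map_zero, LinearMap.zero_apply, star_zero]
    | add w w' h h' => rw [map_add, map_add, LinearMap.add_apply, star_add, h, h']
    | tmul y p =>
      rw [innerLin_tmul, innerLin_tmul, M.form.star_inner, M.inner_left, X.form.star_inner]

theorem innerLin_op_smul (z w : AlgTensor X M) (a : A) :
    innerLin X M z (op a • w) = innerLin X M z w * a := by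
  induction w using induction_on with
  | zero => rw [smul_zero, map_zero, zero_mul]
  | add w w' h h' => rw [smul_add, map_add, map_add, add_mul, h, h']
  | tmul y p =>
    induction z using induction_on with
    | zero => rw [map_zero, LinearMap.zero_apply, LinearMap.zero_apply, zero_mul]
    | add z z' h h' => rw [map_add, LinearMap.add_apply, LinearMap.add_apply, add_mul, h, h']
    | tmul x n =>
      rw [op_smul_tmul, innerLin_tmul, innerLin_tmul, M.left_op_smul, M.form.inner_op_smul_right]

theorem exists_sum_tmul (z : AlgTensor X M) :
    ∃ (s : Finset (X × M)), z = ∑ i ∈ s, tmul i.1 i.2 :=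
  TensorProduct.exists_finset z

theorem innerLin_self_nonneg (z : AlgTensor X M) : 0 ≤ innerLin X M z z := by
  obtain ⟨s, rfl⟩ := exists_sum_tmul z
  obtain ⟨b, hb⟩ := exists_gram (n := s) (fun i j => X.form.inner i.1.1 j.1.1)
    (fun i j => X.form.star_inner _ _) (fun v => by
      have h := X.form.inner_self_nonneg (∑ i : s, op (v i) • i.1.1)
      have h2 : X.form.inner (∑ i : s, op (v i) • i.1.1) (∑ i : s, op (v i) • i.1.1)
          = ∑ i : s, ∑ j : s, star (v i) * X.form.inner i.1.1 j.1.1 * v j := by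
        rw [← X.form.innerₛₗ_apply, LinearMap.map_sum₂]
        refine Finset.sum_congr rfl fun i _ => ?_
        rw [map_sum]
        refine Finset.sum_congr rfl fun j _ => ?_
        rw [X.form.innerₛₗ_apply, X.form.inner_op_smul_left, X.form.inner_op_smul_right, mul_assoc]
      rwa [h2] at h)
  have key : innerLin X M (∑ i ∈ s, tmul i.1 i.2) (∑ i ∈ s, tmul i.1 i.2)
      = ∑ k : s, M.form.inner (∑ i : s, M.left (b k i) i.1.2) (∑ j : s, M.left (b k j) j.1.2) := by
    rw [← Finset.sum_coe_sort s, LinearMap.map_sum₂]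
    have h1 : ∀ i : s, innerLin X M (tmul i.1.1 i.1.2) (∑ j : s, tmul j.1.1 j.1.2)
        = ∑ j : s, ∑ k : s, M.form.inner (M.left (b k i) i.1.2) (M.left (b k j) j.1.2) := by
      intro i
      rw [map_sum]
      refine Finset.sum_congr rfl fun j _ => ?_
      rw [innerLin_tmul, hb i j, map_sum, LinearMap.sum_apply, ← M.form.innerₛₗ_apply, map_sum]
      refine Finset.sum_congr rfl fun k _ => ?_
      rw [M.form.innerₛₗ_apply, map_mul, M.inner_left]
      rfl
    rw [Finset.sum_congr rfl fun i _ => h1 i]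
    have h2 : ∀ k : s,
        M.form.inner (∑ i : s, M.left (b k i) i.1.2) (∑ j : s, M.left (b k j) j.1.2)
        = ∑ i : s, ∑ j : s, M.form.inner (M.left (b k i) i.1.2) (M.left (b k j) j.1.2) := by
      intro k
      rw [← M.form.innerₛₗ_apply, LinearMap.map_sum₂]
      refine Finset.sum_congr rfl fun i _ => ?_
      rw [map_sum]
      rfl
    rw [Finset.sum_congr rfl fun k _ => h2 k, Finset.sum_comm]
    rw [Finset.sum_comm]
    conv_rhs => rw [Finset.sum_comm]
    exact Finset.sum_congr rfl fun i _ => Finset.sum_comm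
  rw [key]
  exact Finset.sum_nonneg fun k _ => M.form.inner_self_nonneg _

variable (X M) in
/-- The pre-inner product `⟨x ⊗ n, y ⊗ p⟩ = ⟨n, ⟨x, y⟩ · p⟩` on `X ⊙ M`. -/
noncomputable def form : PreInner A (AlgTensor X M) where
  inner z w := innerLin X M z w
  inner_add_right _ _ _ := map_add _ _ _
  inner_op_smul_right z w a := innerLin_op_smul z w a
  star_inner := innerLin_star
  inner_self_nonneg := innerLin_self_nonneg

end AlgTensor

namespace HilbertModule

variable (X Y Z : HilbertModule A) (M : Correspondence A)

/-- The internal tensor product `X ⊗_A M`: the Hausdorff completion of `X ⊙ M` for the inner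
product determined by `⟨x ⊗ n, y ⊗ p⟩ = ⟨n, ⟨x, y⟩ · p⟩`. -/
noncomputable def tensor : HilbertModule A := (AlgTensor.form X M).completion

variable {X Y Z M}

/-- The elementary tensor `x ⊗ n` in `X ⊗_A M`. -/
noncomputable def tmul (x : X) (n : M) : X.tensor M :=
  (AlgTensor.form X M).toCompletion (AlgTensor.tmul x n)

theorem inner_tmul (x y : X) (n p : M) :
    ⟪tmul x n, tmul y p⟫ = M.form.inner n (M.left ⟪x, y⟫ p) :=
  (AlgTensor.form X M).inner_toCompletion _ _

theorem tmul_add (x : X) (n p : M) : tmul x (n + p) = tmul x n + tmul x p := by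
  have h : AlgTensor.tmul x (n + p) = AlgTensor.tmul x n + AlgTensor.tmul x p :=
    TensorProduct.tmul_add x n p
  rw [tmul, h, map_add]
  rfl

theorem tmul_op_smul (x : X) (n : M) (a : Aᵐᵒᵖ) : tmul x (a • n) = a • tmul x n := by
  rw [tmul, ← AlgTensor.op_smul_tmul, map_smul]
  rfl

end HilbertModule

namespace InnerMap

variable {X Y Z : HilbertModule A}

/-- `T ⊙ id` on the algebraic tensor products. -/
noncomputable def algTensorMap (T : InnerMap X Y) (M : Correspondence A) :
    AlgTensor X M →ₗ[Aᵐᵒᵖ] AlgTensor Y M :=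
  let f : AlgTensor X M →ₗ[ℂ] AlgTensor Y M := LinearMap.rTensor M
    { toFun := T, map_add' := map_add T, map_smul' := T.map_smul : X →ₗ[ℂ] Y }
  { toFun := f
    map_add' := f.map_add
    map_smul' := fun a z => by
      rw [RingHom.id_apply]
      induction z using AlgTensor.induction_on with
      | zero => rw [smul_zero, map_zero, smul_zero]
      | add z w h h' => rw [smul_add, map_add, map_add, smul_add, h, h']
      | tmul x n => rfl }

theorem algTensorMap_tmul (T : InnerMap X Y) (M : Correspondence A) (x : X) (n : M) :
    T.algTensorMap M (AlgTensor.tmul x n) = AlgTensor.tmul (T x) n := rfl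

theorem inner_algTensorMap (T : InnerMap X Y) (M : Correspondence A) (z w : AlgTensor X M) :
    (AlgTensor.form Y M).inner (T.algTensorMap M z) (T.algTensorMap M w)
      = (AlgTensor.form X M).inner z w := by
  induction z using AlgTensor.induction_on with
  | zero => rw [map_zero, PreInner.inner_zero_left, PreInner.inner_zero_left]
  | add z z' h h' => rw [map_add, PreInner.inner_add_left, PreInner.inner_add_left, h, h']
  | tmul x n =>
    induction w using AlgTensor.induction_on with
    | zero => rw [map_zero, PreInner.inner_zero_right, PreInner.inner_zero_right]
    | add w w' h h' => rw [map_add, PreInner.inner_add_right, PreInner.inner_add_right, h, h']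
    | tmul y p =>
      change M.form.inner n (M.left ⟪T x, T y⟫ p) = M.form.inner n (M.left ⟪x, y⟫ p)
      rw [T.inner_apply]

/-- `T ⊗ id : X ⊗_A M → Y ⊗_A M`, for an inner-product preserving map `T : X → Y`. -/
noncomputable def tensorId (T : InnerMap X Y) (M : Correspondence A) :
    InnerMap (X.tensor M) (Y.tensor M) :=
  PreInner.extend ((AlgTensor.form Y M).toCompletion ∘ₗ T.algTensorMap M) fun z w =>
    ((AlgTensor.form Y M).inner_toCompletion _ _).trans (T.inner_algTensorMap M z w)

theorem tensorId_tmul (T : InnerMap X Y) (M : Correspondence A) (x : X) (n : M) :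
    T.tensorId M (HilbertModule.tmul x n) = HilbertModule.tmul (T x) n :=
  PreInner.extend_toCompletion _ _ _

end InnerMap

/-! ### Tensor powers -/

namespace HilbertModule

/-- `X ⊗_A M^{⊗k} = X ⊗_A M ⊗_A ⋯ ⊗_A M` with `k` factors `M`. -/
noncomputable def tensorPow (X : HilbertModule A) (M : Correspondence A) : ℕ → HilbertModule A
  | 0 => X
  | k + 1 => (X.tensorPow M k).tensor M

/-- For a submodule `V` of `X`, the copy of `V ⊗_A M` in `X ⊗_A M`: the closed submodule generated
by the elementary tensors `v ⊗ n` with `v ∈ V`. -/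
noncomputable def subTensor {X : HilbertModule A} (V : Submodule Aᵐᵒᵖ X) (M : Correspondence A) :
    Submodule Aᵐᵒᵖ (X.tensor M) :=
  (Submodule.span Aᵐᵒᵖ {z | ∃ v ∈ V, ∃ n : M, z = tmul v n}).topologicalClosure

/-- For a submodule `V` of `X`, the copy of `V ⊗_A M^{⊗k}` in `X ⊗_A M^{⊗k}`. -/
noncomputable def subTensorPow {X : HilbertModule A} (V : Submodule Aᵐᵒᵖ X)
    (M : Correspondence A) : (k : ℕ) → Submodule Aᵐᵒᵖ (X.tensorPow M k)
  | 0 => V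
  | k + 1 => subTensor (subTensorPow V M k) M

end HilbertModule

/-- The powers `D^k : X → X ⊗_A M^{⊗k}` of a dilation `D : X → X ⊗_A M`, given by `D^0 = id` and
`D^{k+1} = (D^k ⊗ id) ∘ D`. Each `D^k` is a bijection, since `D` is. -/
noncomputable def HilbertModuleIso.iterate {X : HilbertModule A} {M : Correspondence A}
    (D : HilbertModuleIso X (X.tensor M)) : (k : ℕ) → InnerMap X (X.tensorPow M k)
  | 0 => InnerMap.id X
  | k + 1 => ((D.iterate k).tensorId M).comp D.toInnerMap

namespace Correspondence

variable (M : Correspondence A)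

/-- The tensor powers `M^{⊗k}`, with `M^{⊗0} = A` and `M^{⊗(k+1)} = M^{⊗k} ⊗_A M`. In particular
`M^{⊗1} = A ⊗_A M`, which for essential `M` is identified with `M` through `a ⊗ n ↦ a · n`. -/
noncomputable def pow (k : ℕ) : HilbertModule A := (HilbertModule.self A).tensorPow M k

/-- The element `1` of `M^{⊗0} = A`. -/
def one : M.pow 0 := (1 : A)

/-- The elementary tensor `n₀ ⊗ ⋯ ⊗ n_{k-1}` in `M^{⊗k}`. -/
noncomputable def tprod : (k : ℕ) → (Fin k → M) → M.pow k
  | 0, _ => one M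
  | k + 1, n => HilbertModule.tmul (tprod k (Fin.init n)) (n (Fin.last k))

/-- A filter in `M`. -/
def IsFilter (m : M) : Prop := ⟪(m : M.toHilbertModule), m⟫ = 1

/-- The map `a ↦ e ⊗ m · a`, for `e` in a Hilbert module with `⟨e, e⟩ = 1` and a filter `m`. -/
noncomputable def filterMap {M : Correspondence A} {m : M} (hM : M.IsEssential)
    (hm : M.IsFilter m) {Y : HilbertModule A} (e : Y) (he : ⟪e, e⟫ = 1) :
    InnerMap (HilbertModule.self A) (Y.tensor M) where
  toFun := fun a : A => HilbertModule.tmul e (op a • m)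
  map_add' := fun (a b : A) => by
    rw [← HilbertModule.tmul_add, ← add_smul, ← op_add]; rfl
  map_smul' := fun b (a : A) => by
    rw [RingHom.id_apply, ← HilbertModule.tmul_op_smul, smul_smul]; rfl
  inner_map := fun (a b : A) => by
    have h2 : M.form.inner m m = 1 := hm
    rw [HilbertModule.inner_tmul, he, hM, M.form.inner_op_smul_right, M.form.inner_op_smul_left,
      h2, mul_one]
    rfl

theorem inner_one : ⟪M.one, M.one⟫ = 1 := by
  change star (1 : A) * 1 = 1
  rw [star_one, one_mul]

/-- The maps `T_k : M^{⊗k} → M^{⊗(k+1)}`, `n ↦ m ⊗ n`: `T_0` is `a ↦ m · a`, regarded as a map into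
`A ⊗_A M ≅ M`, and `T_{k+1} = T_k ⊗ id`. See `shift_tprod` for the formula on elementary tensors. -/
noncomputable def shift {M : Correspondence A} {m : M} (hM : M.IsEssential) (hm : M.IsFilter m) :
    (k : ℕ) → InnerMap (M.pow k) (M.pow (k + 1))
  | 0 => filterMap hM hm M.one M.inner_one
  | k + 1 => (shift hM hm k).tensorId M

theorem shift_tprod {M : Correspondence A} {m : M} (hM : M.IsEssential) (hm : M.IsFilter m)
    (k : ℕ) (n : Fin k → M) :
    shift hM hm k (M.tprod k n) = M.tprod (k + 1) (Fin.cons m n) := by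
  induction k with
  | zero =>
    change HilbertModule.tmul M.one (op (1 : A) • m) = HilbertModule.tmul M.one m
    rw [op_one, one_smul]
  | succ k ih =>
    change ((shift hM hm k).tensorId M) (HilbertModule.tmul (M.tprod k (Fin.init n)) (n (Fin.last k)))
      = HilbertModule.tmul (M.tprod (k + 1) (Fin.init (Fin.cons m n : Fin (k + 2) → M)))
        ((Fin.cons m n : Fin (k + 2) → M) (Fin.last (k + 1)))
    rw [InnerMap.tensorId_tmul, ih, ← Fin.succ_last, Fin.cons_succ]
    congr 2
    ext i
    refine Fin.cases ?_ (fun j => ?_) i <;> rfl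

end Correspondence

/-! ### Direct limits -/

section DirectLimit

variable (X : ℕ → HilbertModule A) (T : (k : ℕ) → InnerMap (X k) (X (k + 1)))

/-- The composition `T_{j-1} ∘ ⋯ ∘ T_i : X_i → X_j`. -/
def transition (i j : ℕ) (h : i ≤ j) : X i →ₗ[Aᵐᵒᵖ] X j :=
  Nat.leRecOn (C := fun j => X i →ₗ[Aᵐᵒᵖ] X j) h (fun {k} f => (T k).toLinearMap ∘ₗ f) LinearMap.id

theorem transition_self (i : ℕ) (x : X i) : transition X T i i le_rfl x = x := by
  rw [transition, Nat.leRecOn_self]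
  rfl

theorem transition_succ (i j : ℕ) (h : i ≤ j) (x : X i) :
    transition X T i (j + 1) (h.trans j.le_succ) x = T j (transition X T i j h x) := by
  rw [transition, Nat.leRecOn_succ h]
  rfl

theorem inner_transition (i j : ℕ) (h : i ≤ j) (x y : X i) :
    ⟪transition X T i j h x, transition X T i j h y⟫ = ⟪x, y⟫ := by
  induction j, h using Nat.le_induction with
  | base => rw [transition_self, transition_self]
  | succ j h ih => rw [transition_succ X T i j h, transition_succ X T i j h, (T j).inner_apply, ih]

instance : DirectedSystem (fun k => X k) (fun i j h => transition X T i j h) where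
  map_self i x := transition_self X T i x
  map_map k j i hij hjk x := by
    induction k, hjk using Nat.le_induction with
    | base => rw [transition_self]
    | succ k h ih => rw [transition_succ X T _ k h, transition_succ X T _ k (hij.trans h), ih]

/-- The algebraic direct limit: the quotient of the disjoint union of the `X_k` identifying
`x ∈ X_k` with `T_k x ∈ X_{k+1}`. -/
def AlgLimit : Type u := DirectLimit (fun k => X k) (fun i j h => transition X T i j h)

namespace AlgLimit

noncomputable instance : AddCommGroup (AlgLimit X T) :=
  inferInstanceAs (AddCommGroup (DirectLimit (fun k => X k) (fun i j h => transition X T i j h)))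

noncomputable instance : Module Aᵐᵒᵖ (AlgLimit X T) :=
  inferInstanceAs (Module Aᵐᵒᵖ (DirectLimit (fun k => X k) (fun i j h => transition X T i j h)))

noncomputable instance : Module ℂ (AlgLimit X T) := Module.compHom _ (algebraMap ℂ Aᵐᵒᵖ)

instance : IsScalarTower ℂ Aᵐᵒᵖ (AlgLimit X T) where
  smul_assoc c a x := by
    change (c • a) • x = algebraMap ℂ Aᵐᵒᵖ c • a • x
    rw [smul_smul, Algebra.smul_def]

/-- The class of `x ∈ X_k` in the algebraic direct limit. -/
noncomputable def of (k : ℕ) : X k →ₗ[Aᵐᵒᵖ] AlgLimit X T :=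
  DirectLimit.Module.of Aᵐᵒᵖ ℕ (fun k => X k) (fun i j h => transition X T i j h) k

/-- The inner product of two classes, computed in any `X_k` in which both are represented. -/
noncomputable def inner (x y : AlgLimit X T) : A :=
  DirectLimit.lift₂ (fun i j h => transition X T i j h) (fun i j h => transition X T i j h)
    (fun k (x y : X k) => ⟪x, y⟫)
    (fun i j h x y => (inner_transition X T i j h x y).symm) x y

theorem inner_of (k : ℕ) (x y : X k) : inner X T (of X T k x) (of X T k y) = ⟪x, y⟫ :=
  DirectLimit.lift₂_def (fun i j h => transition X T i j h) (fun i j h => transition X T i j h)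
    (fun k (x y : X k) => ⟪x, y⟫)
    (fun i j h x y => (inner_transition X T i j h x y).symm) k x y

theorem exists_of (x : AlgLimit X T) : ∃ k x', x = of X T k x' :=
  DirectLimit.exists_eq_mk (fun i j h => transition X T i j h) x

theorem exists_of₂ (x y : AlgLimit X T) : ∃ k x' y', x = of X T k x' ∧ y = of X T k y' :=
  DirectLimit.exists_eq_mk₂ (fun i j h => transition X T i j h) x y

theorem exists_of₃ (x y z : AlgLimit X T) :
    ∃ k x' y' z', x = of X T k x' ∧ y = of X T k y' ∧ z = of X T k z' :=
  DirectLimit.exists_eq_mk₃ (fun i j h => transition X T i j h) x y z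

/-- The inner product on the algebraic direct limit. -/
noncomputable def form : PreInner A (AlgLimit X T) where
  inner := inner X T
  inner_add_right x y z := by
    obtain ⟨k, x, y, z, rfl, rfl, rfl⟩ := exists_of₃ X T x y z
    rw [← map_add, inner_of, inner_of, inner_of]
    exact (X k).form.inner_add_right x y z
  inner_op_smul_right x y a := by
    obtain ⟨k, x, y, rfl, rfl⟩ := exists_of₂ X T x y
    rw [← map_smul, inner_of, inner_of]
    exact (X k).form.inner_op_smul_right x y a
  star_inner x y := by
    obtain ⟨k, x, y, rfl, rfl⟩ := exists_of₂ X T x y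
    rw [inner_of, inner_of]
    exact (X k).form.star_inner x y
  inner_self_nonneg x := by
    obtain ⟨k, x, rfl⟩ := exists_of X T x
    rw [inner_of]
    exact (X k).form.inner_self_nonneg x

end AlgLimit

/-- The direct limit `X_∞ = lim (X_k, T_k)` of Hilbert modules: the completion of the algebraic
direct limit. -/
noncomputable def HilbertModule.limit : HilbertModule A := (AlgLimit.form X T).completion

/-- The canonical maps `ι^k : X_k → X_∞`. -/
noncomputable def HilbertModule.ι (k : ℕ) : InnerMap (X k) (HilbertModule.limit X T) where
  toLinearMap := (AlgLimit.form X T).toCompletion ∘ₗ AlgLimit.of X T k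
  inner_map x y := ((AlgLimit.form X T).inner_toCompletion _ _).trans (AlgLimit.inner_of X T k x y)

theorem HilbertModule.ι_succ (k : ℕ) (x : X k) :
    HilbertModule.ι X T (k + 1) (T k x) = HilbertModule.ι X T k x := by
  have h : AlgLimit.of X T (k + 1) (T k x) = AlgLimit.of X T k x := by
    have h1 := transition_succ X T k k le_rfl x
    rw [transition_self] at h1
    rw [← h1]
    exact DirectLimit.Module.of_f
  exact congrArg (AlgLimit.form X T).toCompletion h

end DirectLimit

namespace Correspondence

variable {M : Correspondence A} {m : M} (hM : M.IsEssential) (hm : M.IsFilter m)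

/-- `M_∞ = lim (M^{⊗k}, T_k)`. -/
noncomputable def limit : HilbertModule A := HilbertModule.limit M.pow (shift hM hm)

/-- The canonical maps `ι^k : M^{⊗k} → M_∞`. -/
noncomputable def ι (k : ℕ) : InnerMap (M.pow k) (limit hM hm) :=
  HilbertModule.ι M.pow (shift hM hm) k

end Correspondence

/-! ### Scaling functions and multi-resolution analyses -/

/-- The submodule `V` is a closed complemented submodule of `W`: every `x ∈ W` is a sum `v + w` with
`v ∈ V` and `w ∈ W` orthogonal to `V`. -/
structure IsComplementedIn {X : HilbertModule A} (V W : Submodule Aᵐᵒᵖ X) : Prop where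
  isClosed : IsClosed (V : Set X)
  le : V ≤ W
  exists_add : ∀ x ∈ W, ∃ v ∈ V, ∃ w ∈ W, (∀ v' ∈ V, ⟪v', w⟫ = 0) ∧ v + w = x

/-- `(X, D, φ)` is a scaling function for `m`: `⟨φ, φ⟩ = 1` and `D φ = φ ⊗ m`. -/
structure IsScalingFunction {M : Correspondence A} (m : M) (X : HilbertModule A)
    (D : HilbertModuleIso X (X.tensor M)) (φ : X) : Prop where
  inner_self : ⟪φ, φ⟫ = 1
  dilation : D φ = HilbertModule.tmul φ m

/-- The submodules `V_k` form a projective multi-resolution analysis of the closed submodule `W` of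
`X`, with respect to the dilation `D : X → X ⊗_A M`, which restricts to an isomorphism of `W` onto
`W ⊗_A M`. -/
structure IsProjectiveMRA {M : Correspondence A} {X : HilbertModule A}
    (D : HilbertModuleIso X (X.tensor M)) (W : Submodule Aᵐᵒᵖ X) (V : ℕ → Submodule Aᵐᵒᵖ X) :
    Prop where
  isClosed : IsClosed (W : Set X)
  map_dilation : W.map D.toInnerMap.toLinearMap = HilbertModule.subTensor W M
  complemented_zero : IsComplementedIn (V 0) W
  eq_comap : ∀ k,
    V k = (HilbertModule.subTensorPow (V 0) M k).comap (D.iterate k).toLinearMap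
  complemented_succ : ∀ k, IsComplementedIn (V k) (V (k + 1))
  le : ∀ k, V k ≤ W
  dense : (W : Set X) ⊆ closure (⋃ k, (V k : Set X))

end

/-! The idea is to build `Q` stage by stage. Write `u : A → X`, `a ↦ φ · a`; it preserves inner
products because `⟪φ, φ⟫ = 1`. Tensoring with `M^{⊗k}` and undoing the dilation gives `embed k :
M^{⊗k} → X`, `n ↦ (D^k)⁻¹(φ ⊗ n)`, and `V_k` is its range.

The scaling equation `D φ = φ ⊗ m` says exactly that `u` intertwines `T_0` with `D`, that is `(u ⊗
id) ∘ T_0 = D ∘ u`. Tensoring this square with `M^{⊗k}` yields `embed (k+1) ∘ T_k = embed k`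
(`embed_succ_comp_shift`), so the maps glue to `Q` on the direct limit. Likewise the maps `ι^k ⊗ id`
glue to `R` (`exists_limit_iso`), which is onto because its closed range contains all `ι^k(x) ⊗ n`.
The relation `D ∘ Q = (Q ⊗ id) ∘ R` then reads `D ∘ embed (k+1) = embed k ⊗ id` at each stage, which
is the recursion `D^{k+1} = (D^k ⊗ id) ∘ D` (`dilation_comp_embed`). The other half of the argument
needs the recursion in the form `D^{k+1} = (D ⊗ id) ∘ D^k`; `iterate_succ` reconciles the two.

Closedness is automatic, since isometries of complete spaces have closed range. Complementedness is
not, as inner-product preserving maps need not be adjointable. It starts from the rank-one case,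
where `x ↦ φ · ⟪φ, x⟫` is the projection. For the inclusions `V_k ⊆ V_{k+1}`, the range of `T_0` is
such a rank-one submodule, generated by `1 ⊗ m`; complementedness passes from `T` to `T ⊗ id`
(`isComplementedIn_range_tensorId`), hence to every `T_k`, and is carried into `X` by `embed (k+1)`.
Density of the union is density of the stages in the direct limit. -/

section

variable {A : Type u} [CStarAlgebra A] [PartialOrder A] [StarOrderedRing A]

/-! ### Inner-product preserving maps as isometries -/

namespace InnerMap

variable {X Y Z : HilbertModule A}

theorem comp_apply (S : InnerMap Y Z) (T : InnerMap X Y) (x : X) : S.comp T x = S (T x) := rfl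

theorem norm_apply (T : InnerMap X Y) (x : X) : ‖T x‖ = ‖x‖ := by
  refine (sq_eq_sq₀ (norm_nonneg _) (norm_nonneg _)).1 ?_
  rw [Y.norm_sq, X.norm_sq]
  exact congrArg norm (T.inner_apply x x)

theorem isometry (T : InnerMap X Y) : Isometry T :=
  AddMonoidHomClass.isometry_of_norm T T.norm_apply

theorem injective (T : InnerMap X Y) : Function.Injective T := T.isometry.injective

/-- The range, as a submodule. -/
def range (T : InnerMap X Y) : Submodule Aᵐᵒᵖ Y := LinearMap.range T.toLinearMap

theorem mem_range_self (T : InnerMap X Y) (x : X) : T x ∈ T.range := ⟨x, rfl⟩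

/-- The domain is complete, so an isometry on it is a closed embedding. Closedness of `W` and of
every `V_k` comes from here. -/
theorem isClosed_range (T : InnerMap X Y) : IsClosed (T.range : Set Y) :=
  T.isometry.isClosedEmbedding.isClosed_range

theorem surjective_of_range_eq_top {T : InnerMap X Y} (h : T.range = ⊤) :
    Function.Surjective T := fun _ => (h ▸ Submodule.mem_top : _ ∈ T.range)

theorem isClosed_eqLocus (S T : InnerMap X Y) : IsClosed {x | S x = T x} :=
  isClosed_eq S.isometry.continuous T.isometry.continuous

/-- A surjective inner-product preserving map is an isomorphism. -/
noncomputable def toIso (T : InnerMap X Y) (h : Function.Surjective T) : HilbertModuleIso X Y where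
  toLinearEquiv := LinearEquiv.ofBijective T.toLinearMap ⟨T.injective, h⟩
  inner_map := T.inner_map

end InnerMap

/-! ### Elementary tensors: continuity and density -/

namespace HilbertModule

variable {X Y : HilbertModule A} {M : Correspondence A}

theorem inner_add_right (x y z : X) : ⟪x, y + z⟫ = ⟪x, y⟫ + ⟪x, z⟫ := X.form.inner_add_right x y z

theorem inner_sub_right (x y z : X) : ⟪x, y - z⟫ = ⟪x, y⟫ - ⟪x, z⟫ := X.form.inner_sub_right x y z

theorem inner_op_smul_right (x y : X) (a : A) : ⟪x, op a • y⟫ = ⟪x, y⟫ * a :=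
  X.form.inner_op_smul_right x y a

theorem inner_op_smul_left (x y : X) (a : A) : ⟪op a • x, y⟫ = star a * ⟪x, y⟫ :=
  X.form.inner_op_smul_left x y a

theorem inner_zero_right (x : X) : ⟪x, 0⟫ = 0 := X.form.inner_zero_right x

theorem star_inner (x y : X) : star ⟪x, y⟫ = ⟪y, x⟫ := X.form.star_inner x y

theorem add_tmul (x y : X) (n : M) : tmul (x + y) n = tmul x n + tmul y n := by
  have h : AlgTensor.tmul (x + y) n = AlgTensor.tmul x n + AlgTensor.tmul y n :=
    TensorProduct.add_tmul x y n
  rw [tmul, h, map_add]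
  rfl

/-- The inequality `⟪x, x⟫ ≤ ‖x‖² · 1` in `A` is transported through the left action. The factor
`left 1` remains because `M` is not assumed essential here. The point is continuity of `x ↦ x ⊗ n`.
-/
theorem norm_tmul_sq_le (x : X) (n : M) :
    ‖tmul x n‖ ^ 2 ≤ ‖x‖ ^ 2 * ‖M.form.inner n (M.left 1 n)‖ := by
  have h0 : 0 ≤ M.form.inner n (M.left ⟪x, x⟫ n) :=
    ((AlgTensor.form X M).inner_self_nonneg (AlgTensor.tmul x n) :)
  have h1 : ⟪x, x⟫ ≤ algebraMap ℝ A (‖x‖ ^ 2) := by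
    rw [X.norm_sq]
    exact (IsSelfAdjoint.of_nonneg (X.form.inner_self_nonneg x)).le_algebraMap_norm_self
  -- Positivity of the left action is seen from a factorization: `⟨n, b⋆b · n⟩ = ⟨b · n, b · n⟩ ≥
  -- 0`.
  obtain ⟨b, hb⟩ := CStarAlgebra.nonneg_iff_eq_star_mul_self.1 (sub_nonneg.2 h1)
  have h2 : (algebraMap ℝ A (‖x‖ ^ 2) : A) = ((‖x‖ ^ 2 : ℝ) : ℂ) • (1 : A) := by
    rw [Algebra.algebraMap_eq_smul_one, Complex.coe_smul]
  have h3 : M.form.inner n (M.left (star b * b) n)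
      = M.form.inner (M.left b n) (M.left b n) := by
    rw [map_mul, M.inner_left]
    rfl
  have h4 : M.form.inner n (M.left ⟪x, x⟫ n) ≤ (‖x‖ ^ 2) • M.form.inner n (M.left 1 n) := by
    have h5 := M.form.inner_self_nonneg (M.left b n)
    rw [← h3, ← hb, h2, map_sub, map_smul, LinearMap.sub_apply, LinearMap.smul_apply,
      M.form.inner_sub_right, M.form.inner_smul_right, Complex.coe_smul] at h5
    exact sub_nonneg.1 h5
  have h6 := CStarAlgebra.norm_le_norm_of_nonneg_of_le h0 h4
  rw [norm_smul, Real.norm_of_nonneg (sq_nonneg _)] at h6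
  have h7 : (X.tensor M).form.inner (tmul x n) (tmul x n)
      = M.form.inner n (M.left ⟪x, x⟫ n) := inner_tmul x x n n
  rw [(X.tensor M).norm_sq, h7]
  exact h6

theorem continuous_tmul_left (n : M) : Continuous fun x : X => tmul x n := by
  let f : X →+ X.tensor M := AddMonoidHom.mk' (fun x => tmul x n) fun x y => add_tmul x y n
  refine AddMonoidHomClass.continuous_of_bound f √‖M.form.inner n (M.left 1 n)‖ fun x => ?_
  refine le_of_sq_le_sq ?_ (by positivity)
  rw [mul_pow, Real.sq_sqrt (norm_nonneg _), mul_comm]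
  exact norm_tmul_sq_le x n

/-- A closed submodule of `X ⊗_A M` containing all elementary tensors is everything. -/
theorem eq_top_of_tmul_mem {V : Submodule Aᵐᵒᵖ (X.tensor M)}
    (hV : IsClosed (V : Set (X.tensor M))) (h : ∀ x n, tmul x n ∈ V) : V = ⊤ := by
  refine eq_top_iff.2 fun z _ => ?_
  refine (AlgTensor.form X M).completion_induction (p := fun z => z ∈ V) z hV fun e => ?_
  induction e using AlgTensor.induction_on with
  | zero => rw [map_zero]; exact V.zero_mem
  | tmul x n => exact h x n
  | add z w hz hw => rw [map_add]; exact V.add_mem hz hw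

theorem tmul_mem_subTensor {V : Submodule Aᵐᵒᵖ X} {x : X} (hx : x ∈ V) (n : M) :
    tmul x n ∈ subTensor V M :=
  Submodule.le_topologicalClosure _ (Submodule.subset_span ⟨x, hx, n, rfl⟩)

theorem subTensor_le {V : Submodule Aᵐᵒᵖ X} {U : Submodule Aᵐᵒᵖ (X.tensor M)}
    (hU : IsClosed (U : Set (X.tensor M))) (h : ∀ x ∈ V, ∀ n : M, tmul x n ∈ U) :
    subTensor V M ≤ U :=
  Submodule.topologicalClosure_minimal _
    (Submodule.span_le.2 (by rintro _ ⟨x, hx, n, rfl⟩; exact h x hx n)) hU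

end HilbertModule

/-! ### Functoriality of `⊗ id` and ranges of tensored maps -/

namespace InnerMap

open HilbertModule

variable {X Y Z : HilbertModule A} {M : Correspondence A}

theorem tensor_ext {S T : InnerMap (X.tensor M) Z} (h : ∀ x n, S (tmul x n) = T (tmul x n)) :
    S = T := by
  have h1 : LinearMap.eqLocus S.toLinearMap T.toLinearMap = ⊤ :=
    eq_top_of_tmul_mem (S.isClosed_eqLocus T) h
  refine DFunLike.ext _ _ fun z => ?_
  have h2 : z ∈ LinearMap.eqLocus S.toLinearMap T.toLinearMap := h1 ▸ Submodule.mem_top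
  exact h2

theorem tensorId_comp (S : InnerMap Y Z) (T : InnerMap X Y) :
    (S.comp T).tensorId M = (S.tensorId M).comp (T.tensorId M) :=
  tensor_ext fun x n => by
    rw [comp_apply, tensorId_tmul, tensorId_tmul, tensorId_tmul, comp_apply]

/-- Both sides are closed, so each inclusion needs to be tested only on elementary tensors. This
links the concrete copy of `V ⊗ M` inside `Y ⊗ M` with maps, for `V` the range of an isometry. -/
theorem range_tensorId (T : InnerMap X Y) : (T.tensorId M).range = subTensor T.range M := by
  refine le_antisymm ?_ (subTensor_le (T.tensorId M).isClosed_range ?_)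
  · have h : (subTensor T.range M).comap (T.tensorId M).toLinearMap = ⊤ := by
      refine eq_top_of_tmul_mem ((Submodule.isClosed_topologicalClosure _).preimage
        (T.tensorId M).isometry.continuous) fun x n => ?_
      change T.tensorId M (tmul x n) ∈ subTensor T.range M
      rw [tensorId_tmul]
      exact tmul_mem_subTensor (T.mem_range_self x) n
    rintro _ ⟨z, rfl⟩
    have hz : z ∈ (subTensor T.range M).comap (T.tensorId M).toLinearMap := h ▸ Submodule.mem_top
    exact hz
  · rintro _ ⟨x, rfl⟩ n
    exact ⟨tmul x n, T.tensorId_tmul M x n⟩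

theorem tensorId_surjective {T : InnerMap X Y} (h : Function.Surjective T) :
    Function.Surjective (T.tensorId M) := by
  refine surjective_of_range_eq_top
    (eq_top_of_tmul_mem (T.tensorId M).isClosed_range fun y n => ?_)
  obtain ⟨x, rfl⟩ := h y
  exact ⟨tmul x n, T.tensorId_tmul M x n⟩

/-- `T ⊗ id : X ⊗_A M^{⊗k} → Y ⊗_A M^{⊗k}`. -/
noncomputable def tensorPow (T : InnerMap X Y) (M : Correspondence A) :
    (k : ℕ) → InnerMap (X.tensorPow M k) (Y.tensorPow M k)
  | 0 => T
  | k + 1 => (T.tensorPow M k).tensorId M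

theorem range_tensorPow (T : InnerMap X Y) (k : ℕ) :
    (T.tensorPow M k).range = subTensorPow T.range M k := by
  induction k with
  | zero => rfl
  | succ k ih =>
    change ((T.tensorPow M k).tensorId M).range = subTensor (subTensorPow T.range M k) M
    rw [range_tensorId, ih]

/-- The maps `S ⊗ id : X ⊗_A M^{⊗k} → X ⊗_A M^{⊗(k+1)}` for `S : X → X ⊗_A M`. -/
noncomputable def amplify (S : InnerMap X (X.tensor M)) :
    (k : ℕ) → InnerMap (X.tensorPow M k) (X.tensorPow M (k + 1))
  | 0 => S
  | k + 1 => (S.amplify k).tensorId M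

/-- An intertwining relation is preserved by tensoring with `M^{⊗k}`. -/
theorem tensorPow_comp_amplify {S : InnerMap X (X.tensor M)} {S' : InnerMap Y (Y.tensor M)}
    {T : InnerMap X Y} (h : (T.tensorId M).comp S = S'.comp T) (k : ℕ) :
    (T.tensorPow M (k + 1)).comp (S.amplify k) = (S'.amplify k).comp (T.tensorPow M k) := by
  induction k with
  | zero => exact h
  | succ k ih =>
    change ((T.tensorPow M (k + 1)).tensorId M).comp ((S.amplify k).tensorId M)
      = ((S'.amplify k).tensorId M).comp ((T.tensorPow M k).tensorId M)
    rw [← tensorId_comp, ih, tensorId_comp]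

end InnerMap

/-! ### Powers of the dilation -/

namespace HilbertModuleIso

variable {X Y : HilbertModule A} {M : Correspondence A}

theorem toInnerMap_surjective (U : HilbertModuleIso X Y) : Function.Surjective U.toInnerMap :=
  U.toLinearEquiv.surjective

theorem iterate_surjective (D : HilbertModuleIso X (X.tensor M)) (k : ℕ) :
    Function.Surjective (D.iterate k) := by
  induction k with
  | zero => exact Function.surjective_id
  | succ k ih => exact (InnerMap.tensorId_surjective ih).comp D.toInnerMap_surjective

/-- `D^{k+1} = (D ⊗ id) ∘ D^k`. -/
theorem iterate_succ (D : HilbertModuleIso X (X.tensor M)) (k : ℕ) :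
    D.iterate (k + 1) = (D.toInnerMap.amplify k).comp (D.iterate k) := by
  induction k with
  | zero =>
    change ((InnerMap.id X).tensorId M).comp D.toInnerMap = D.toInnerMap.comp (InnerMap.id X)
    have h : (InnerMap.id X).tensorId M = InnerMap.id _ :=
      InnerMap.tensor_ext fun x n => InnerMap.tensorId_tmul _ _ _ _
    rw [h]
    rfl
  | succ k ih =>
    change ((D.iterate (k + 1)).tensorId M).comp D.toInnerMap
      = ((D.toInnerMap.amplify k).tensorId M).comp (((D.iterate k).tensorId M).comp D.toInnerMap)
    rw [ih, InnerMap.tensorId_comp]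
    rfl

/-- `D^k` as an isomorphism. -/
noncomputable def iterateIso (D : HilbertModuleIso X (X.tensor M)) (k : ℕ) :
    HilbertModuleIso X (X.tensorPow M k) :=
  (D.iterate k).toIso (D.iterate_surjective k)

/-- The inverse isomorphism. -/
def symm (U : HilbertModuleIso X Y) : HilbertModuleIso Y X where
  toLinearEquiv := U.toLinearEquiv.symm
  inner_map x y := by
    have h := U.inner_map (U.toLinearEquiv.symm x) (U.toLinearEquiv.symm y)
    refine h.symm.trans (congrArg₂ HilbertModule.inner ?_ ?_)
    · exact U.toLinearEquiv.apply_symm_apply x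
    · exact U.toLinearEquiv.apply_symm_apply y

end HilbertModuleIso

/-! ### Universal property of direct limits -/

section DirectLimit

variable {X : ℕ → HilbertModule A} {T : (k : ℕ) → InnerMap (X k) (X (k + 1))}
  {Z : HilbertModule A}

namespace HilbertModule

theorem eq_top_of_ι_mem {V : Submodule Aᵐᵒᵖ (limit X T)} (hV : IsClosed (V : Set (limit X T)))
    (h : ∀ k x, ι X T k x ∈ V) : V = ⊤ := by
  refine eq_top_iff.2 fun z _ => ?_
  refine (AlgLimit.form X T).completion_induction (p := fun z => z ∈ V) z hV fun e => ?_
  obtain ⟨k, x, rfl⟩ := AlgLimit.exists_of X T e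
  exact h k x

theorem denseRange_ι (z : limit X T) : z ∈ closure (⋃ k, ((ι X T k).range : Set (limit X T))) := by
  refine (AlgLimit.form X T).completion_induction
    (p := fun z => z ∈ closure (⋃ k, ((ι X T k).range : Set (limit X T)))) z isClosed_closure
    fun e => ?_
  obtain ⟨k, x, rfl⟩ := AlgLimit.exists_of X T e
  exact subset_closure (Set.mem_iUnion.2 ⟨k, x, rfl⟩)

/-- Stage 0 can be omitted since `ι^0` factors through `ι^1`. This matters because `R` is prescribed
only on the stages `k + 1`, where a last tensor factor can be split off. -/
theorem limit_ext {S S' : InnerMap (limit X T) Z}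
    (h : ∀ k, S.comp (ι X T (k + 1)) = S'.comp (ι X T (k + 1))) : S = S' := by
  have h1 : LinearMap.eqLocus S.toLinearMap S'.toLinearMap = ⊤ := by
    refine eq_top_of_ι_mem (S.isClosed_eqLocus S') fun k x => ?_
    rw [← ι_succ]
    exact DFunLike.congr_fun (h k) (T k x)
  refine DFunLike.ext _ _ fun z => ?_
  have h2 : z ∈ LinearMap.eqLocus S.toLinearMap S'.toLinearMap := h1 ▸ Submodule.mem_top
  exact h2

variable (f : (k : ℕ) → InnerMap (X k) Z) (hf : ∀ k, (f (k + 1)).comp (T k) = f k)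

/-- A compatible family of maps `X_k → Z`, as a map on the algebraic direct limit. -/
noncomputable def algLift : AlgLimit X T →ₗ[Aᵐᵒᵖ] Z :=
  DirectLimit.Module.lift Aᵐᵒᵖ ℕ (fun k => X k) (fun i j h => transition X T i j h)
    (fun k => (f k).toLinearMap) fun i j h x => by
      induction j, h using Nat.le_induction with
      | base => rw [transition_self]
      | succ j h ih =>
        rw [transition_succ X T i j h, ← ih]
        exact DFunLike.congr_fun (hf j) _

theorem algLift_of (k : ℕ) (x : X k) : algLift f hf (AlgLimit.of X T k x) = f k x := rfl

theorem inner_algLift (x y : AlgLimit X T) :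
    ⟪algLift f hf x, algLift f hf y⟫ = (AlgLimit.form X T).inner x y := by
  obtain ⟨k, x, y, rfl, rfl⟩ := AlgLimit.exists_of₂ X T x y
  rw [algLift_of, algLift_of, (f k).inner_apply]
  exact (AlgLimit.inner_of X T k x y).symm

/-- A compatible family of inner-product preserving maps `X_k → Z` induces a map `X_∞ → Z`. -/
noncomputable def limitLift : InnerMap (limit X T) Z :=
  PreInner.extend (algLift f hf) (inner_algLift f hf)

theorem limitLift_comp_ι (k : ℕ) : (limitLift f hf).comp (ι X T k) = f k :=
  DFunLike.ext _ _ fun x => PreInner.extend_toCompletion (algLift f hf) (inner_algLift f hf) (AlgLimit.of X T k x)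

/-- The map `X_∞ → X_∞ ⊗_A M` is onto once its range contains all `ι^k(x) ⊗ n`. -/
theorem surjective_of_range_ι_tensorId_le {M : Correspondence A}
    {R : InnerMap Z ((limit X T).tensor M)}
    (h : ∀ k, ((ι X T k).tensorId M).range ≤ R.range) : Function.Surjective R := by
  refine InnerMap.surjective_of_range_eq_top
    (eq_top_of_tmul_mem R.isClosed_range fun z n => ?_)
  -- For fixed `n` the set of good `z` is closed, by continuity of `z ↦ z ⊗ n`, and it contains the
  -- dense union of the stages.
  refine closure_minimal (t := {z | tmul z n ∈ R.range}) ?_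
    (R.isClosed_range.preimage (continuous_tmul_left n)) (denseRange_ι z)
  refine Set.iUnion_subset fun k => ?_
  rintro _ ⟨x, rfl⟩
  exact h k ⟨tmul x n, InnerMap.tensorId_tmul _ _ _ _⟩

end HilbertModule

end DirectLimit

/-! ### Complemented submodules -/

namespace HilbertModule

variable {X Y : HilbertModule A} {M : Correspondence A}

/-- The orthogonal complement of a submodule. -/
def orthogonal (V : Submodule Aᵐᵒᵖ X) : Submodule Aᵐᵒᵖ X where
  carrier := {w | ∀ v ∈ V, ⟪v, w⟫ = 0}
  add_mem' hx hy v hv := by rw [inner_add_right, hx v hv, hy v hv, add_zero]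
  zero_mem' v _ := inner_zero_right v
  smul_mem' a x hx v hv := by
    rw [← op_unop a, inner_op_smul_right, hx v hv, zero_mul]

theorem mem_orthogonal {V : Submodule Aᵐᵒᵖ X} {w : X} :
    w ∈ orthogonal V ↔ ∀ v ∈ V, ⟪v, w⟫ = 0 := Iff.rfl

theorem isClosed_orthogonal (V : Submodule Aᵐᵒᵖ X) : IsClosed (orthogonal V : Set X) := by
  have h : (orthogonal V : Set X) = ⋂ v ∈ V, {w | ⟪v, w⟫ = 0} := by
    ext w
    simp [mem_orthogonal]
  rw [h]
  exact isClosed_biInter fun v _ => isClosed_eq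
    (X.continuous_inner.comp (continuous_const.prodMk continuous_id)) continuous_const

/-- Pythagoras holds in `A`: `⟪v + w, v + w⟫ = ⟪v, v⟫ + ⟪w, w⟫ ≥ ⟪v, v⟫`, and the norm is monotone
on positive elements. -/
theorem norm_le_norm_add {v w : X} (h : ⟪v, w⟫ = 0) : ‖v‖ ≤ ‖v + w‖ := by
  refine le_of_sq_le_sq ?_ (norm_nonneg _)
  rw [X.norm_sq, X.norm_sq]
  refine CStarAlgebra.norm_le_norm_of_nonneg_of_le (X.form.inner_self_nonneg v) ?_
  have h' : X.form.inner w v = 0 := by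
    rw [← X.form.star_inner]
    exact (congrArg star h).trans (star_zero A)
  have h'' : X.form.inner v w = 0 := h
  rw [X.form.inner_add_left, X.form.inner_add_right, X.form.inner_add_right, h', h'', add_zero,
    zero_add]
  exact le_add_of_nonneg_right (X.form.inner_self_nonneg w)

/-- Addition `V × V^⊥ → X` is bounded below on a complete space, so its range is closed. Hence a
decomposition `V ⊔ V^⊥ = ⊤` may be checked on a set generating a dense submodule. -/
theorem isClosed_sup_orthogonal {V : Submodule Aᵐᵒᵖ X} (hV : IsClosed (V : Set X)) :
    IsClosed ((V ⊔ orthogonal V : Submodule Aᵐᵒᵖ X) : Set X) := by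
  have := hV.completeSpace_coe
  have := (isClosed_orthogonal V).completeSpace_coe
  let f : V.toAddSubgroup × (orthogonal V).toAddSubgroup →+ X :=
    V.toAddSubgroup.subtype.coprod (orthogonal V).toAddSubgroup.subtype
  -- The product carries the sup norm, so the bounds `‖v‖ ≤ ‖v + w‖` and `‖w‖ ≤ ‖v + w‖` give the
  -- constant 1.
  have h1 : AntilipschitzWith 1 f := by
    refine AddMonoidHomClass.antilipschitz_of_bound f fun p => ?_
    obtain ⟨v, w⟩ := p
    have h : ⟪(v : X), (w : X)⟫ = 0 := w.2 v v.2
    have h' : ⟪(w : X), (v : X)⟫ = 0 := by rw [← star_inner, h, star_zero]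
    rw [NNReal.coe_one, one_mul]
    refine max_le (norm_le_norm_add h) ((norm_le_norm_add h').trans_eq ?_)
    rw [add_comm]
    rfl
  have h2 : UniformContinuous f :=
    (uniformContinuous_subtype_val.comp uniformContinuous_fst).add
      (uniformContinuous_subtype_val.comp uniformContinuous_snd)
  have h3 := h1.isClosed_range h2
  convert h3 using 1
  ext x
  simp only [SetLike.mem_coe, Submodule.mem_sup, Set.mem_range]
  constructor
  · rintro ⟨v, hv, w, hw, rfl⟩
    exact ⟨(⟨v, hv⟩, ⟨w, hw⟩), rfl⟩
  · rintro ⟨⟨v, w⟩, rfl⟩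
    exact ⟨v, v.2, w, w.2, rfl⟩

theorem isComplementedIn_top_iff {V : Submodule Aᵐᵒᵖ X} :
    IsComplementedIn V ⊤ ↔ IsClosed (V : Set X) ∧ V ⊔ orthogonal V = ⊤ := by
  constructor
  · intro h
    refine ⟨h.isClosed, eq_top_iff.2 fun x _ => ?_⟩
    obtain ⟨v, hv, w, -, hw, rfl⟩ := h.exists_add x Submodule.mem_top
    exact Submodule.add_mem_sup hv hw
  · rintro ⟨h, h'⟩
    refine ⟨h, le_top, fun x _ => ?_⟩
    obtain ⟨v, hv, w, hw, hx⟩ := Submodule.mem_sup.1 (h' ▸ Submodule.mem_top : x ∈ _)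
    exact ⟨v, hv, w, Submodule.mem_top, hw, hx⟩

/-- `a ↦ φ · a`, for `φ` with `⟨φ, φ⟩ = 1`. -/
noncomputable def unitMap (φ : X) (hφ : ⟪φ, φ⟫ = 1) : InnerMap (HilbertModule.self A) X where
  toFun := fun a : A => op a • φ
  map_add' := fun (a b : A) => by rw [← add_smul, ← op_add]; rfl
  map_smul' := fun b (a : A) => by rw [RingHom.id_apply, smul_smul]; rfl
  inner_map := fun (a b : A) => by
    rw [inner_op_smul_left, inner_op_smul_right, hφ, one_mul]
    rfl

/-- The projection is `x ↦ φ · ⟪φ, x⟫`; it does not leave `W` because `φ ∈ W`. -/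
theorem isComplementedIn_range_unitMap {φ : X} (hφ : ⟪φ, φ⟫ = 1) {W : Submodule Aᵐᵒᵖ X}
    (hW : φ ∈ W) : IsComplementedIn (unitMap φ hφ).range W where
  isClosed := InnerMap.isClosed_range _
  le := by
    rintro _ ⟨a, rfl⟩
    exact W.smul_mem _ hW
  exists_add x hx := by
    refine ⟨op ⟪φ, x⟫ • φ, ⟨(⟪φ, x⟫ : A), rfl⟩, x - op ⟪φ, x⟫ • φ,
      W.sub_mem hx (W.smul_mem _ hW), ?_, add_sub_cancel _ _⟩
    rintro _ ⟨a, rfl⟩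
    change ⟪op (show A from a) • φ, _⟫ = 0
    rw [inner_op_smul_left, inner_sub_right, inner_op_smul_right, hφ, one_mul, sub_self, mul_zero]

end HilbertModule

namespace InnerMap

open HilbertModule

variable {X Y Z : HilbertModule A} {M : Correspondence A}

/-- If `y = T x + w` with `w` orthogonal to the range of `T`, then `y ⊗ n = T x ⊗ n + w ⊗ n`, and
`⟪T x' ⊗ p, w ⊗ n⟫ = ⟨p, ⟪T x', w⟫ · n⟩ = 0`. Elementary tensors suffice because the sum with the
orthogonal complement is closed. -/
theorem isComplementedIn_range_tensorId {T : InnerMap X Y} (h : IsComplementedIn T.range ⊤) :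
    IsComplementedIn (T.tensorId M).range ⊤ := by
  have hc : IsClosed ((T.tensorId M).range : Set (Y.tensor M)) := (T.tensorId M).isClosed_range
  refine isComplementedIn_top_iff.2
    ⟨hc, eq_top_of_tmul_mem (isClosed_sup_orthogonal hc) fun y n => ?_⟩
  obtain ⟨_, ⟨x, rfl⟩, w, -, hw, rfl⟩ := h.exists_add y Submodule.mem_top
  rw [add_tmul]
  refine Submodule.add_mem_sup ⟨tmul x n, T.tensorId_tmul M x n⟩ fun z hz => ?_
  -- The orthogonality is turned around: the vectors orthogonal to `w ⊗ n` form a closed submodule,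
  -- so it is enough that it contains the generators of the range.
  have h1 : (T.tensorId M).range ≤ orthogonal (Submodule.span Aᵐᵒᵖ {tmul w n}) := by
    rw [range_tensorId]
    refine subTensor_le (isClosed_orthogonal _) fun v hv p => ?_
    intro u hu
    obtain ⟨a, rfl⟩ := Submodule.mem_span_singleton.1 hu
    have h2 : ⟪w, v⟫ = 0 := by rw [← star_inner, hw v hv, star_zero]
    rw [← op_unop a, inner_op_smul_left, inner_tmul, h2, map_zero, LinearMap.zero_apply,
      M.form.inner_zero_right, mul_zero]
  rw [← star_inner, h1 hz _ (Submodule.mem_span_singleton_self _), star_zero]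

theorem isComplementedIn_range_amplify {S : InnerMap X (X.tensor M)}
    (h : IsComplementedIn S.range ⊤) (k : ℕ) : IsComplementedIn (S.amplify k).range ⊤ := by
  induction k with
  | zero => exact h
  | succ k ih => exact isComplementedIn_range_tensorId ih

/-- `U` maps orthogonal decompositions in `Y` to orthogonal decompositions in its range, so no
complement of `U.range` in `Z` is required. -/
theorem isComplementedIn_range_comp {T : InnerMap X Y} (h : IsComplementedIn T.range ⊤)
    (U : InnerMap Y Z) : IsComplementedIn (U.comp T).range U.range where
  isClosed := isClosed_range _
  le := by
    rintro _ ⟨x, rfl⟩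
    exact ⟨T x, rfl⟩
  exists_add := by
    rintro _ ⟨y, rfl⟩
    obtain ⟨_, ⟨x, rfl⟩, w, -, hw, rfl⟩ := h.exists_add y Submodule.mem_top
    refine ⟨U (T x), ⟨x, rfl⟩, U w, U.mem_range_self w, ?_, (map_add U _ _).symm⟩
    rintro _ ⟨x', rfl⟩
    exact (U.inner_apply (T x') w).trans (hw _ (T.mem_range_self x'))

end InnerMap

/-! ### The shifts `T_k` and the isomorphism `R` -/

namespace Correspondence

open HilbertModule

variable {M : Correspondence A} {m : M} (hM : M.IsEssential) (hm : M.IsFilter m)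

theorem shift_eq_amplify (k : ℕ) :
    shift hM hm k = (shift hM hm 0).amplify k := by
  induction k with
  | zero => rfl
  | succ k ih =>
    exact congrArg (fun S : InnerMap (M.pow k) (M.pow (k + 1)) => S.tensorId M) ih

theorem isComplementedIn_range_shift (k : ℕ) : IsComplementedIn (shift hM hm k).range ⊤ := by
  rw [shift_eq_amplify]
  refine InnerMap.isComplementedIn_range_amplify ?_ k
  have h1 : ⟪tmul M.one m, tmul M.one m⟫ = 1 := by
    rw [inner_tmul, M.inner_one, hM]
    exact hm
  -- Since `1 ⊗ m · a = (1 ⊗ m) · a`, the map `T_0` is itself of the form `a ↦ e · a` with `⟪e, e⟫ =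
  -- 1`.
  have h2 : shift hM hm 0 = unitMap (tmul M.one m) h1 :=
    DFunLike.ext _ _ fun a => tmul_op_smul _ _ _
  rw [h2]
  exact isComplementedIn_range_unitMap h1 Submodule.mem_top

/-- The isomorphism `M_∞ ≅ M_∞ ⊗_A M` induced by `M^{⊗(k+1)} = M^{⊗k} ⊗_A M`. -/
theorem exists_limit_iso : ∃ R : HilbertModuleIso (limit hM hm) ((limit hM hm).tensor M),
    ∀ k, R.toInnerMap.comp (ι hM hm (k + 1)) = (ι hM hm k).tensorId M := by
  have hι : ∀ k, (ι hM hm (k + 1)).comp (shift hM hm k) = ι hM hm k := fun k =>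
    DFunLike.ext _ _ fun x => HilbertModule.ι_succ M.pow (shift hM hm) k x
  -- There is no `ι^{-1} ⊗ id`, so the map on stage 0 is forced by compatibility with `T_0`.
  let f : (k : ℕ) → InnerMap (M.pow k) ((limit hM hm).tensor M)
    | 0 => ((ι hM hm 0).tensorId M).comp (shift hM hm 0)
    | k + 1 => (ι hM hm k).tensorId M
  have hf : ∀ k, (f (k + 1)).comp (shift hM hm k) = f k
    | 0 => rfl
    | k + 1 => by
      change ((ι hM hm (k + 1)).tensorId M).comp ((shift hM hm k).tensorId M)
        = (ι hM hm k).tensorId M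
      rw [← InnerMap.tensorId_comp, hι]
  have h1 : ∀ k, (limitLift f hf).comp (ι hM hm (k + 1)) = (ι hM hm k).tensorId M :=
    fun k => limitLift_comp_ι f hf (k + 1)
  refine ⟨(limitLift f hf).toIso (surjective_of_range_ι_tensorId_le fun k => ?_), h1⟩
  rintro _ ⟨z, rfl⟩
  exact ⟨ι hM hm (k + 1) z, DFunLike.congr_fun (h1 k) z⟩

end Correspondence

/-! ### The embeddings `M^{⊗k} → X` defined by a scaling function -/

namespace IsScalingFunction

open HilbertModule

variable {M : Correspondence A} {m : M} {X : HilbertModule A}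
  {D : HilbertModuleIso X (X.tensor M)} {φ : X}

/-- The map `M^{⊗k} → X` sending `n` to `(D^k)⁻¹ (φ ⊗ n)`. -/
noncomputable def embed (h : IsScalingFunction m X D φ) (k : ℕ) : InnerMap (M.pow k) X :=
  (D.iterateIso k).symm.toInnerMap.comp ((unitMap φ h.inner_self).tensorPow M k)

theorem iterate_comp_embed (h : IsScalingFunction m X D φ) (k : ℕ) :
    (D.iterate k).comp (h.embed k) = (unitMap φ h.inner_self).tensorPow M k :=
  DFunLike.ext _ _ fun _ => (D.iterateIso k).toLinearEquiv.apply_symm_apply _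

/-- Up to `D^{k+1}` this is `φ ⊗ m ⊗ n = (D φ) ⊗ n`. It is the compatibility that lets the
embeddings descend to the direct limit. -/
theorem embed_succ_comp_shift (h : IsScalingFunction m X D φ) (hM : M.IsEssential)
    (hm : M.IsFilter m) (k : ℕ) :
    (h.embed (k + 1)).comp (Correspondence.shift hM hm k) = h.embed k := by
  -- The scaling equation as a commuting square: both maps send `a` to `(φ ⊗ m) · a`.
  have h1 : ((unitMap φ h.inner_self).tensorId M).comp (Correspondence.shift hM hm 0)
      = D.toInnerMap.comp (unitMap φ h.inner_self) := by
    refine DFunLike.ext _ _ fun a => ?_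
    change (unitMap φ h.inner_self).tensorId M (tmul M.one (op (show A from a) • m))
      = D.toInnerMap (op (show A from a) • φ)
    refine (InnerMap.tensorId_tmul _ _ _ _).trans ?_
    have h2 : unitMap φ h.inner_self M.one = φ := one_smul _ φ
    rw [D.toInnerMap.map_op_smul, tmul_op_smul, h2]
    exact congrArg _ h.dilation.symm
  have h3 := InnerMap.tensorPow_comp_amplify h1 k
  rw [← Correspondence.shift_eq_amplify] at h3
  -- After `D^{k+1}` the left side is `φ ⊗ T_k x`, and the right side is `(D ⊗ id)(D^k (embed k x))
  -- = (D ⊗ id)(φ ⊗ x)`.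
  refine DFunLike.ext _ _ fun x => (D.iterate (k + 1)).injective ?_
  have h4 := DFunLike.congr_fun (h.iterate_comp_embed (k + 1)) (Correspondence.shift hM hm k x)
  refine h4.trans ((DFunLike.congr_fun h3 x).trans ?_)
  rw [D.iterate_succ]
  exact congrArg (D.toInnerMap.amplify k) (DFunLike.congr_fun (h.iterate_comp_embed k) x).symm

/-- Under the injective map `D^k ⊗ id` both sides become `x ↦ φ ⊗ x`, because `(D^k ⊗ id) ∘ D` is
`D^{k+1}` by definition. The scaling equation plays no role. -/
theorem dilation_comp_embed (h : IsScalingFunction m X D φ) (k : ℕ) :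
    D.toInnerMap.comp (h.embed (k + 1)) = (h.embed k).tensorId M := by
  refine DFunLike.ext _ _ fun x => ((D.iterate k).tensorId M).injective ?_
  have h1 := InnerMap.tensorId_comp (M := M) (D.iterate k) (h.embed k)
  rw [h.iterate_comp_embed k] at h1
  exact (DFunLike.congr_fun (h.iterate_comp_embed (k + 1)) x).trans (DFunLike.congr_fun h1 x)

/-- The range of `D^k ∘ embed k` is `V_0 ⊗ M^{⊗k}`, and injectivity of `D^k` makes the range of
`embed k` the full preimage. -/
theorem range_embed (h : IsScalingFunction m X D φ) (k : ℕ) :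
    (h.embed k).range
      = (subTensorPow (unitMap φ h.inner_self).range M k).comap (D.iterate k).toLinearMap := by
  rw [← InnerMap.range_tensorPow, ← h.iterate_comp_embed]
  ext x
  constructor
  · rintro ⟨y, rfl⟩
    exact ⟨y, rfl⟩
  · rintro ⟨y, hy⟩
    exact ⟨y, (D.iterate k).injective hy⟩

end IsScalingFunction

end

/-! ### The main theorem -/

theorem mainTheorem4 {A : Type u} [CStarAlgebra A] [PartialOrder A] [StarOrderedRing A]
    (M : Correspondence A) (hM : M.IsEssential) (m : M) (hm : M.IsFilter m)
    (X : HilbertModule A) (D : HilbertModuleIso X (X.tensor M)) (φ : X)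
    (hφ : IsScalingFunction m X D φ) :
    ∃ R : HilbertModuleIso (Correspondence.limit hM hm) ((Correspondence.limit hM hm).tensor M),
      (∀ k, R.toInnerMap.comp (Correspondence.ι hM hm (k + 1)) =
        (Correspondence.ι hM hm k).tensorId M) ∧
      ∃ Q : InnerMap (Correspondence.limit hM hm) X,
        Q (Correspondence.ι hM hm 0 M.one) = φ ∧
        D.toInnerMap.comp Q = (Q.tensorId M).comp R.toInnerMap ∧
        ∃ V : ℕ → Submodule Aᵐᵒᵖ X,
          (∀ k, V k = LinearMap.range (Q.comp (Correspondence.ι hM hm k)).toLinearMap) ∧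
          IsProjectiveMRA D (LinearMap.range Q.toLinearMap) V ∧
          (V 0 : Set X) = Set.range (fun a : A => MulOpposite.op a • φ) ∧
          Function.Injective (fun a : A => MulOpposite.op a • φ) := by
  obtain ⟨R, hR⟩ := Correspondence.exists_limit_iso hM hm
  let Q : InnerMap (Correspondence.limit hM hm) X :=
    HilbertModule.limitLift hφ.embed (hφ.embed_succ_comp_shift hM hm)
  have hQ : ∀ k, Q.comp (Correspondence.ι hM hm k) = hφ.embed k :=
    HilbertModule.limitLift_comp_ι hφ.embed (hφ.embed_succ_comp_shift hM hm)
  have h0 : hφ.embed 0 = HilbertModule.unitMap φ hφ.inner_self := hφ.iterate_comp_embed 0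
  have hDQ : D.toInnerMap.comp Q = (Q.tensorId M).comp R.toInnerMap := by
    refine HilbertModule.limit_ext fun k => ?_
    change D.toInnerMap.comp (Q.comp (Correspondence.ι hM hm (k + 1)))
      = (Q.tensorId M).comp (R.toInnerMap.comp (Correspondence.ι hM hm (k + 1)))
    -- On stage `k + 1` the two sides become `embed k ⊗ id` and `(Q ⊗ id) ∘ (ι^k ⊗ id)`, which agree
    -- by functoriality.
    rw [hR, hQ, hφ.dilation_comp_embed, ← hQ]
    exact InnerMap.tensorId_comp _ _
  have h1 : Q (Correspondence.ι hM hm 0 M.one) = φ := by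
    rw [← InnerMap.comp_apply, hQ, h0]
    exact one_smul _ φ
  refine ⟨R, hR, Q, h1, hDQ, fun k => (hφ.embed k).range, fun k => by rw [hQ]; rfl, ?_, ?_, ?_⟩
  · refine
      { isClosed := Q.isClosed_range
        map_dilation := ?_
        complemented_zero := ?_
        eq_comap := fun k => ?_
        complemented_succ := fun k => ?_
        le := fun k => ?_
        dense := ?_ }
    · change Q.range.map D.toInnerMap.toLinearMap = HilbertModule.subTensor Q.range M
      rw [← InnerMap.range_tensorId]
      ext z
      constructor
      · rintro ⟨_, ⟨x, rfl⟩, rfl⟩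
        exact ⟨R.toInnerMap x, (DFunLike.congr_fun hDQ x).symm⟩
      · rintro ⟨y, rfl⟩
        -- Surjectivity of `R` is what makes `D` map `W` onto all of `W ⊗ M`.
        obtain ⟨x, rfl⟩ := R.toInnerMap_surjective y
        exact ⟨Q x, Q.mem_range_self x, DFunLike.congr_fun hDQ x⟩
    · rw [h0]
      exact HilbertModule.isComplementedIn_range_unitMap _ ⟨_, h1⟩
    · rw [h0]
      exact hφ.range_embed k
    -- The range of `T_k` is complemented in `M^{⊗(k+1)}`, and `embed (k + 1)` carries this pair
    -- onto `V_k ⊆ V_{k+1}`.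
    · have h := InnerMap.isComplementedIn_range_comp
        (Correspondence.isComplementedIn_range_shift hM hm k) (hφ.embed (k + 1))
      rwa [hφ.embed_succ_comp_shift hM hm] at h
    · rw [← hQ]
      rintro _ ⟨x, rfl⟩
      exact Q.mem_range_self _
    · rintro _ ⟨z, rfl⟩
      -- The stages `ι^k(M^{⊗k})` are dense in `M_∞`, and the continuous map `Q` sends their closure
      -- into the closure of the union of the `V_k`.
      refine closure_mono ?_ (image_closure_subset_closure_image Q.isometry.continuous
        (Set.mem_image_of_mem Q (HilbertModule.denseRange_ι z)))
      rintro _ ⟨_, hz, rfl⟩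
      obtain ⟨k, x, rfl⟩ := Set.mem_iUnion.1 hz
      exact Set.mem_iUnion.2 ⟨k, x, (DFunLike.congr_fun (hQ k) x).symm⟩
  · change ((hφ.embed 0).range : Set X) = _
    rw [h0]
    rfl
  · exact (HilbertModule.unitMap φ hφ.inner_self).injective
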